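/- Let $X = L^2(\mathbb R^6;(1+|v|^2)^2\,dx\,dv)$ be the space of real-valued functions of $(x,v)\in\mathbb R^3\times\mathbb R^3$ with norm $\|u\|_X^2=\iint |u(x,v)|^2(1+|v|^2)^2\,dx\,dv$; for a velocity gradient write $\|\nabla_v u\|_X^2=\iint |\nabla_v u|^2(1+|v|^2)^2\,dx\,dv$, where $\nabla_v u$ is taken in the weak sense. For $z\in X$ let $n[z](x)=\int_{\mathbb R^3} z(x,v)\,dv$ and let $V[z]=-\frac1{4\pi|x|}*n[z]$ be its Newton potential, normalised by an additive constant so that the integral converges for every density in $L^2(\mathbb R^3)$: $$V[z](x)=-\frac1{4\pi}\int_{\mathbb R^3}\Big(\frac1{|x-y|}-\frac1{1+|y|}\Big)\,n[z](y)\,dy .$$ For a potential $V$ put $\delta V(x,\eta)=V(x+\frac\eta2)-V(x-\frac\eta2)$ (which does not depend on the additive constant) and $$\Theta[V]u(x,v)=\mathcal F^{-1}_{\eta\to v}\big(i\,\delta V(x,\eta)\,\mathcal F_{v\to\eta}u(x,\eta)\big),\qquad \mathcal F_{v\to\eta}u(x,\eta)=(2\pi)^{-3/2}\int_{\mathbb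 R^3} u(x,v)e^{-iv\cdot\eta}\,dv ,$$ where $\mathcal F^{-1}_{\eta\to v}$ is the inverse Fourier transform on $L^2(\mathbb R^3)$, taken for almost every $x$. For every $z\in X$ the integral defining $n[z](x)$ converges absolutely for almost every $x$, $n[z]\in L^2(\mathbb R^3)$, and the integral defining $V[z](x)$ converges absolutely for every $x\in\mathbb R^3$. Moreover, there is an absolute constant $C$ such that, for every $u\in X$ with $\nabla_v u\in X$, the map $z\mapsto\Theta[V[z]]u$ is well defined, is a bounded linear operator from $X$ into $X$, and satisfies $$\|\Theta[V[z]]u\|_X\le C\,\big(\|u\|_X+\|\nabla_v u\|_X\big)\,\|z\|_X\qquad\text{for all } z\in X .$$ -/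

import Mathlib

open MeasureTheory
open scoped FourierTransform ContDiff ENNReal

noncomputable section

namespace WPFP

/-- Position space and velocity space: `ℝ³` with its Euclidean norm. -/
abbrev R3 : Type := EuclideanSpace ℝ (Fin 3)

/-- The measure `(1 + |v|²)² dx dv` on the phase space `ℝ³ × ℝ³`. -/
def weightedMeasure : Measure (R3 × R3) :=
  (volume : Measure (R3 × R3)).withDensity
    (fun p => ENNReal.ofReal ((1 + ‖p.2‖ ^ 2) ^ 2))

/-- The state space `X = L²(ℝ⁶; (1 + |v|²)² dx dv)` of real-valued functions. -/
abbrev X : Type := Lp ℝ 2 weightedMeasure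

/-- Vector fields `ℝ⁶ → ℝ³` whose three components are in `X`, with norm
`‖g‖² = ∫∫ |g(x,v)|² (1 + |v|²)² dx dv`. -/
abbrev XVec : Type := Lp R3 2 weightedMeasure

/-- `g` is the weak gradient of `u` in the velocity variable:
`∫∫ u ∂_{v_i} φ dx dv = - ∫∫ g_i φ dx dv` for all test functions `φ ∈ C_c^∞(ℝ⁶)`, `i = 1, 2, 3`. -/
def IsWeakGradV (u : R3 × R3 → ℝ) (g : R3 × R3 → R3) : Prop :=
  ∀ φ : R3 × R3 → ℝ, ContDiff ℝ ∞ φ → HasCompactSupport φ → ∀ i : Fin 3,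
    ∫ p, u p * fderiv ℝ φ p (0, EuclideanSpace.single i 1) = - ∫ p, g p i * φ p

/-- The particle density `n[w](x) = ∫ w(x,v) dv`. -/
def density (w : R3 × R3 → ℝ) (x : R3) : ℝ := ∫ v, w (x, v)

/-- The kernel `1/|x-y| - 1/(1+|y|)`. The Coulomb kernel `1/|x-y|` is not square integrable at
infinity, so that `1/|x| * n` need not converge for `n ∈ L²`; subtracting a function of `y` alone
changes the potential by an additive constant only and makes the integral converge. -/
def newtonKernel (x y : R3) : ℝ := 1 / ‖x - y‖ - 1 / (1 + ‖y‖)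

/-- The Newton potential `V = -1/(4π|x|) * n`, normalised by an additive constant. -/
def newtonPotential (n : R3 → ℝ) (x : R3) : ℝ :=
  -(1 / (4 * Real.pi)) * ∫ y, newtonKernel x y * n y

/-- If the convolution `1/|x| * n` converges, the potential is `-1/(4π|x|) * n` up to the additive
constant `1/(4π) ∫ n(y)/(1+|y|) dy`. -/
theorem newtonPotential_eq_convolution_add_const (n : R3 → ℝ) (x : R3)
    (h : Integrable (fun y : R3 => 1 / ‖x - y‖ * n y))
    (h0 : Integrable (fun y : R3 => 1 / (1 + ‖y‖) * n y)) :
    newtonPotential n x = -(1 / (4 * Real.pi)) * (∫ y, 1 / ‖x - y‖ * n y)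
      + 1 / (4 * Real.pi) * ∫ y, 1 / (1 + ‖y‖) * n y := by
  unfold newtonPotential newtonKernel
  simp_rw [sub_mul]
  rw [integral_sub h h0]
  ring

/-- The potential difference `δV(x,η) = V(x + η/2) - V(x - η/2)`. -/
def delta (V : R3 → ℝ) (x η : R3) : ℝ :=
  V (x + (1 / 2 : ℝ) • η) - V (x - (1 / 2 : ℝ) • η)

/-- The normalisation drops out of `δV`, which is `1/(4π) (f(·;η) * n)(x)` with the dipole kernel
`f(y;η) = 1/|y - η/2| - 1/|y + η/2|`. -/
theorem delta_newtonPotential (n : R3 → ℝ) (x η : R3)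
    (h : ∀ x : R3, Integrable (fun y : R3 => newtonKernel x y * n y)) :
    delta (newtonPotential n) x η = 1 / (4 * Real.pi) *
      ∫ y, (1 / ‖y - (1 / 2 : ℝ) • η‖ - 1 / ‖y + (1 / 2 : ℝ) • η‖) * n (x - y) := by
  have hd : delta (newtonPotential n) x η = 1 / (4 * Real.pi) *
      ∫ y, (1 / ‖x - y - (1 / 2 : ℝ) • η‖ - 1 / ‖x - y + (1 / 2 : ℝ) • η‖) * n y := by
    unfold delta newtonPotential
    rw [← mul_sub, ← integral_sub (h _) (h _), neg_mul, ← mul_neg, ← integral_neg]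
    congr 2
    funext y
    unfold newtonKernel
    rw [show x + (1 / 2 : ℝ) • η - y = x - y + (1 / 2 : ℝ) • η by abel,
      show x - (1 / 2 : ℝ) • η - y = x - y - (1 / 2 : ℝ) • η by abel]
    ring
  rw [hd, ← integral_sub_left_eq_self _ volume x]
  simp only [sub_sub_cancel]

/-- The Fourier transform in velocity,
`(F_{v→η} w)(x,η) = (2π)^{-3/2} ∫ w(x,v) e^{-i v·η} dv`. For `w ∈ X` the integral converges
absolutely for almost every `x`. -/
def fourierV (w : R3 × R3 → ℝ) (x η : R3) : ℂ :=
  (((2 * Real.pi) ^ (-(3 / 2) : ℝ) : ℝ) : ℂ) *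
    ∫ v : R3, (w (x, v) : ℂ) * Complex.exp (-(Complex.I * ((inner ℝ v η : ℝ) : ℂ)))

/-- The inverse Fourier transform on `L²(ℝ³; ℂ)`, normalised as
`g ↦ (2π)^{-3/2} ∫ g(η) e^{i v·η} dη`: Mathlib's unitary `𝓕⁻` on `L²` has the phase
`e^{2πi v·η}`, hence the dilation. -/
def fourierInvL2 (g : Lp ℂ 2 (volume : Measure R3)) (v : R3) : ℂ :=
  (((2 * Real.pi) ^ (-(3 / 2) : ℝ) : ℝ) : ℂ) *
    (𝓕⁻ g : Lp ℂ 2 (volume : Measure R3)) ((2 * Real.pi)⁻¹ • v)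

/-- `w = Θ[V]u`, where `Θ[V]u = F_{η→v}^{-1} (i δV(x,η) (F_{v→η} u)(x,η))` is the
pseudo-differential (Wigner) operator with symbol `i δV`: for almost every `x`, `u(x,·)` is
integrable, `η ↦ i δV(x,η) (F_{v→η} u)(x,η)` is in `L²(ℝ³)`, and `w(x,·)` is its inverse Fourier
transform. -/
def IsWignerOp (V : R3 → ℝ) (u w : R3 × R3 → ℝ) : Prop :=
  ∀ᵐ x : R3, Integrable (fun v => u (x, v)) ∧
    ∃ h : MemLp (fun η : R3 => Complex.I * (delta V x η : ℂ) * fourierV u x η) 2 volume,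
      ∀ᵐ v : R3, (w (x, v) : ℂ) = fourierInvL2 (h.toLp _) v

end WPFP

end

/-! The operator becomes an explicit frequency integral. With `𝓕` normalised by `e^{-2πi x·ξ}`, a
difference of Newton potentials is `-1/(4π²) ∫ |ξ|⁻² (e^{2πi x₁·ξ} - e^{2πi x₂·ξ}) (𝓕 n)(ξ) dξ`. At
`x ± η/2` the factors `e^{±πi η·ξ}` are the multipliers of the velocity translations by `±πξ`, so
that `Θ[V[z]]u(x,v) = -i/(4π²) ∫ (𝓕 n)(ξ) |ξ|⁻² e^{2πi x·ξ} (u(x,v+πξ) - u(x,v-πξ)) dξ`.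

The estimate puts absolute values inside this integral and weights it by `1+|v|²`. For `|ξ| < 1` the
velocity difference gains a factor `|ξ|` from `∇_v u`, and the remaining `|ξ|⁻¹` is square
integrable near `0` in dimension three. For `|ξ| ≥ 1` one has `1+|v|² ≤ 2(1+|v±πξ|²) + 2π²|ξ|²`. The
first term travels with `u` and leaves `|ξ|⁻²`, which is square integrable at infinity. The second
cancels `|ξ|⁻²` and leaves the velocity convolution of `|𝓕 n|` with `|u|`, controlled by Young's
inequality `L² * L¹ → L²`, because the weight puts `u` in `L²_x L¹_v`. Minkowski, Cauchy–Schwarz in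
`ξ` and Plancherel then bound everything by `‖n‖₂`, hence by `‖z‖`. The pointwise splitting is
`weighted_velocityDiff_le` and the result is `exists_lintegral_wigner_sq_le`.

The formula for the potential is proved on Schwartz functions by writing the Coulomb kernel as a
superposition of Gaussians, and extends to `L²` by density (`integral_newtonKernel_sub_mul`). Fubini
identifies the velocity transform of the frequency integral with `i δV` times that of `u`
(`integral_wignerIntegral_mul_osc`). On almost every fibre both the integral and its transform are
square integrable, so Fourier inversion applies, and the Hermitian symmetry of the symbol makes the
result real (`wigner_fiber`). -/

noncomputable section

namespace WPFP

/-! ### Integrability of the Coulomb kernel -/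

/-- The square integrable majorant `1 / (|y| (1 + |y|))` of differences of Coulomb kernels and of
the symbols of their Fourier transforms. -/
def decayKernel (y : R3) : ℝ := 1 / (‖y‖ * (1 + ‖y‖))

lemma decayKernel_nonneg (y : R3) : 0 ≤ decayKernel y := by unfold decayKernel; positivity

lemma measurable_decayKernel : Measurable decayKernel := by
  unfold decayKernel; fun_prop

lemma integrable_decayKernel_sq : Integrable (fun y => decayKernel y ^ 2) := by
  have h := (integrable_fun_norm_addHaar (E := R3) volume
    (f := fun r : ℝ => (1 / (r * (1 + r))) ^ 2)).2
  refine h ?_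
  have h1 : IntegrableOn (fun r : ℝ => (1 + ‖r‖) ^ (-2 : ℝ)) (Set.Ioi 0) :=
    (integrable_one_add_norm (by simp)).integrableOn
  -- In polar coordinates the Jacobian `r²` cancels the singularity and leaves `(1+r)⁻²`.
  refine h1.congr_fun (fun r hr => ?_) measurableSet_Ioi
  have hr' : (0 : ℝ) < r := hr
  simp only [finrank_euclideanSpace, Fintype.card_fin, smul_eq_mul]
  rw [Real.norm_of_nonneg hr'.le, Real.rpow_neg (by positivity)]
  norm_num
  field_simp

lemma memLp_decayKernel : MemLp decayKernel 2 volume :=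
  (memLp_two_iff_integrable_sq measurable_decayKernel.aestronglyMeasurable).2
    integrable_decayKernel_sq

/-- Over a common denominator the numerator `1+|y|-|x-y|` is at most `1+|x|` in modulus: the
subtraction gains one power of decay. The other factor `1+|x|` exchanges `1+|y|` for `1+|x-y|`. -/
lemma abs_newtonKernel_le {x y : R3} (hxy : x ≠ y) :
    |newtonKernel x y| ≤ (1 + ‖x‖) ^ 2 * decayKernel (x - y) := by
  unfold newtonKernel decayKernel
  have hr : 0 < ‖x - y‖ := norm_pos_iff.2 (sub_ne_zero.2 hxy)
  have h1 : ‖x - y‖ ≤ ‖x‖ + ‖y‖ := norm_sub_le x y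
  have h2 : ‖y‖ ≤ ‖x - y‖ + ‖x‖ := by
    have := norm_sub_le x (x - y); rw [sub_sub_cancel] at this; linarith
  have hx := norm_nonneg x
  have hy := norm_nonneg y
  have h3 : 1 + ‖x - y‖ ≤ (1 + ‖x‖) * (1 + ‖y‖) := by nlinarith
  rw [div_sub_div _ _ hr.ne' (by positivity), abs_div, abs_of_pos (by positivity : 0 < ‖x - y‖ * (1 + ‖y‖)),
    mul_one_div, div_le_div_iff₀ (by positivity) (by positivity)]
  have h4 : |1 * (1 + ‖y‖) - ‖x - y‖ * 1| ≤ 1 + ‖x‖ := by rw [abs_le]; constructor <;> linarith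
  calc |1 * (1 + ‖y‖) - ‖x - y‖ * 1| * (‖x - y‖ * (1 + ‖x - y‖))
      ≤ (1 + ‖x‖) * (‖x - y‖ * ((1 + ‖x‖) * (1 + ‖y‖))) := by gcongr
    _ = _ := by ring

lemma measurable_newtonKernel (x : R3) : Measurable (newtonKernel x) := by
  unfold newtonKernel; fun_prop

lemma memLp_newtonKernel (x : R3) : MemLp (newtonKernel x) 2 volume := by
  have h1 : MemLp (fun y => decayKernel (x - y)) 2 volume :=
    memLp_decayKernel.comp_measurePreserving (Measure.measurePreserving_sub_left volume x)
  refine h1.of_le_mul (c := (1 + ‖x‖) ^ 2) (measurable_newtonKernel x).aestronglyMeasurable ?_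
  filter_upwards [compl_mem_ae_iff.2 (measure_singleton x)] with y hy
  rw [Real.norm_of_nonneg (decayKernel_nonneg _)]
  exact abs_newtonKernel_le fun h => hy h.symm

/-! ### Weights -/

/-- The weight `1 + |v|²`. -/
def wt (v : R3) : ℝ := 1 + ‖v‖ ^ 2

lemma one_le_wt (v : R3) : 1 ≤ wt v := by unfold wt; nlinarith [sq_nonneg ‖v‖]
lemma wt_pos (v : R3) : 0 < wt v := lt_of_lt_of_le one_pos (one_le_wt v)
lemma continuous_wt : Continuous wt := by unfold wt; fun_prop

/-- Two ways of moving the weight along a translation. The multiplicative form serves bounded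
shifts; the additive form below keeps the growth in the shift separate, to be cancelled by `|ξ|⁻²`.
-/
lemma wt_le_mul (v w : R3) : wt v ≤ 2 * wt (v - w) * wt w := by
  unfold wt
  have h : ‖v‖ ≤ ‖v - w‖ + ‖w‖ := norm_le_norm_sub_add v w
  nlinarith [norm_nonneg v, norm_nonneg w, norm_nonneg (v - w), sq_nonneg (‖v - w‖ - ‖w‖),
    mul_nonneg (sq_nonneg ‖v - w‖) (sq_nonneg ‖w‖)]

lemma wt_le_add (v w : R3) : wt v ≤ 2 * wt (v - w) + 2 * ‖w‖ ^ 2 := by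
  unfold wt
  have h : ‖v‖ ≤ ‖v - w‖ + ‖w‖ := norm_le_norm_sub_add v w
  nlinarith [norm_nonneg v, norm_nonneg w, norm_nonneg (v - w), sq_nonneg (‖v - w‖ - ‖w‖)]

lemma memLp_one_div_wt : MemLp (fun v => 1 / wt v) 2 volume := by
  have hm : AEStronglyMeasurable (fun v => 1 / wt v) volume :=
    (continuous_const.div continuous_wt fun v => (wt_pos v).ne').aestronglyMeasurable
  refine (memLp_two_iff_integrable_sq hm).2 ?_
  refine ((integrable_one_add_norm (E := R3) (μ := volume) (r := 4) (by simp; norm_num)).const_mul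
    4).mono' (hm.pow 2) (Filter.Eventually.of_forall fun v => ?_)
  have h0 := wt_pos v
  rw [Real.norm_of_nonneg (by positivity), Real.rpow_neg (by positivity), div_pow, one_pow,
    ← div_eq_mul_inv, div_le_div_iff₀ (by positivity) (by positivity)]
  norm_cast
  have : (1 + ‖v‖) ^ 2 ≤ 2 * wt v := by unfold wt; nlinarith [sq_nonneg (‖v‖ - 1)]
  calc 1 * (1 + ‖v‖) ^ 4 = ((1 + ‖v‖) ^ 2) ^ 2 := by ring
    _ ≤ (2 * wt v) ^ 2 := by gcongr
    _ = _ := by ring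

/-- The density is strictly positive, so the null sets are those of Lebesgue measure and
almost-everywhere identities in `X` pass to fibres. -/
lemma volume_ac_weightedMeasure : (volume : Measure (R3 × R3)) ≪ weightedMeasure := by
  refine withDensity_absolutelyContinuous' (by fun_prop) (Filter.Eventually.of_forall fun p => ?_)
  simp only [ne_eq, ENNReal.ofReal_eq_zero, not_le]
  positivity

lemma weightedMeasure_ac_volume : weightedMeasure ≪ (volume : Measure (R3 × R3)) :=
  withDensity_absolutelyContinuous _ _

variable {E : Type*} [NormedAddCommGroup E]

lemma lintegral_weightedMeasure (f : R3 × R3 → ℝ≥0∞) (hf : AEMeasurable f) :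
    ∫⁻ p, f p ∂weightedMeasure = ∫⁻ p : R3 × R3, ENNReal.ofReal (wt p.2) ^ 2 * f p := by
  unfold weightedMeasure
  rw [lintegral_withDensity_eq_lintegral_mul₀ (by fun_prop) hf]
  refine lintegral_congr fun p => ?_
  simp only [Pi.mul_apply, wt]
  rw [ENNReal.ofReal_pow (by positivity)]

lemma eLpNorm_two_sq {α F : Type*} {_ : MeasurableSpace α} [NormedAddCommGroup F]
    (μ : Measure α) (f : α → F) : eLpNorm f 2 μ ^ 2 = ∫⁻ p, ‖f p‖ₑ ^ 2 ∂μ := by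
  have h := eLpNorm_nnreal_pow_eq_lintegral (μ := μ) (f := f) (p := 2) (by norm_num)
  simpa using h

/-- The squared norm of `X` as a Lebesgue integral. -/
lemma eLpNorm_weighted_sq (f : R3 × R3 → E) (hf : AEStronglyMeasurable f weightedMeasure) :
    eLpNorm f 2 weightedMeasure ^ 2 =
      ∫⁻ p : R3 × R3, ENNReal.ofReal (wt p.2) ^ 2 * ‖f p‖ₑ ^ 2 := by
  rw [eLpNorm_two_sq, lintegral_weightedMeasure]
  exact ((hf.mono_ac volume_ac_weightedMeasure).enorm).pow_const 2

lemma enorm_Lp_weighted_sq (f : Lp E 2 weightedMeasure) :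
    ENNReal.ofReal ‖f‖ ^ 2 = ∫⁻ p : R3 × R3, ENNReal.ofReal (wt p.2) ^ 2 * ‖f p‖ₑ ^ 2 := by
  rw [← eLpNorm_weighted_sq _ (Lp.aestronglyMeasurable f), Lp.norm_def,
    ENNReal.ofReal_toReal (Lp.eLpNorm_ne_top f)]

lemma memLp_volume_of_weighted {f : R3 × R3 → E} (hf : MemLp f 2 weightedMeasure) :
    MemLp f 2 (volume : Measure (R3 × R3)) := by
  have hm := hf.1.mono_ac volume_ac_weightedMeasure
  refine ⟨hm, ?_⟩
  have h := eLpNorm_weighted_sq f hf.1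
  have h2 : eLpNorm f 2 volume ^ 2 ≤ eLpNorm f 2 weightedMeasure ^ 2 := by
    rw [h, eLpNorm_two_sq]
    refine lintegral_mono fun p => ?_
    refine le_mul_of_one_le_left' (one_le_pow₀ ?_)
    simpa using ENNReal.ofReal_le_ofReal (one_le_wt p.2)
  have h3 : eLpNorm f 2 volume ^ 2 < ⊤ := h2.trans_lt (ENNReal.pow_lt_top hf.2)
  exact (ENNReal.pow_lt_top_iff.1 h3).resolve_right (by norm_num)

/-! ### Cauchy–Schwarz in extended nonnegative form -/

lemma lintegral_mul_sq_le {α : Type*} {_ : MeasurableSpace α} {μ : Measure α}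
    {f g : α → ℝ≥0∞} (hf : AEMeasurable f μ) (hg : AEMeasurable g μ) :
    (∫⁻ a, f a * g a ∂μ) ^ 2 ≤ (∫⁻ a, f a ^ 2 ∂μ) * ∫⁻ a, g a ^ 2 ∂μ := by
  have h := ENNReal.lintegral_mul_le_Lp_mul_Lq μ Real.HolderConjugate.two_two hf hg
  have h2 : ∀ z : ℝ≥0∞, (z ^ (1 / 2 : ℝ)) ^ 2 = z := fun z => by
    rw [← ENNReal.rpow_natCast, ← ENNReal.rpow_mul]; norm_num
  calc (∫⁻ a, f a * g a ∂μ) ^ 2 ≤ _ := pow_le_pow_left' h 2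
    _ = _ := by rw [mul_pow, h2, h2]; simp

/-- Cauchy–Schwarz for the measure `f dμ`, from the factorisation `f g = √f · (√f g)`. Both the
Minkowski and the Young bounds rest on it. -/
lemma lintegral_mul_sq_le_lintegral_mul {α : Type*} {_ : MeasurableSpace α} {μ : Measure α}
    {f g : α → ℝ≥0∞} (hf : AEMeasurable f μ) (hg : AEMeasurable g μ) :
    (∫⁻ a, f a * g a ∂μ) ^ 2 ≤ (∫⁻ a, f a ∂μ) * ∫⁻ a, f a * g a ^ 2 ∂μ := by
  have h2 : ∀ z : ℝ≥0∞, (z ^ (1 / 2 : ℝ)) ^ 2 = z := fun z => by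
    rw [← ENNReal.rpow_natCast, ← ENNReal.rpow_mul]; norm_num
  have h := lintegral_mul_sq_le (hf.pow_const (1 / 2 : ℝ)) ((hf.pow_const (1 / 2 : ℝ)).mul hg)
  simp only [Pi.mul_apply, mul_pow, h2, ← mul_assoc] at h
  simpa only [← sq, h2] using h

/-- Minkowski's integral inequality in `L²`, with a uniform bound on the fibres. -/
lemma lintegral_sq_lintegral_mul_le {α β : Type*} {_ : MeasurableSpace α} {_ : MeasurableSpace β}
    {μ : Measure α} {ν : Measure β} [SFinite μ] [SFinite ν] {k : β → ℝ≥0∞} {F : β → α → ℝ≥0∞}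
    (hk : Measurable k) (hF : Measurable (Function.uncurry F)) {M : ℝ≥0∞}
    (hM : ∀ b, ∫⁻ a, F b a ^ 2 ∂μ ≤ M) :
    ∫⁻ a, (∫⁻ b, k b * F b a ∂ν) ^ 2 ∂μ ≤ (∫⁻ b, k b ∂ν) ^ 2 * M := by
  have hF' : Measurable (fun p : α × β => F p.2 p.1) := hF.comp measurable_swap
  calc ∫⁻ a, (∫⁻ b, k b * F b a ∂ν) ^ 2 ∂μ
      ≤ ∫⁻ a, (∫⁻ b, k b ∂ν) * ∫⁻ b, k b * F b a ^ 2 ∂ν ∂μ := by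
        refine lintegral_mono fun a => ?_
        exact lintegral_mul_sq_le_lintegral_mul hk.aemeasurable
          (hF'.comp measurable_prodMk_left).aemeasurable
    _ = (∫⁻ b, k b ∂ν) * ∫⁻ a, ∫⁻ b, k b * F b a ^ 2 ∂ν ∂μ := by
        refine lintegral_const_mul _ ?_
        exact ((hk.comp measurable_snd).mul (hF'.pow_const 2)).lintegral_prod_right'
    _ = (∫⁻ b, k b ∂ν) * ∫⁻ b, k b * ∫⁻ a, F b a ^ 2 ∂μ ∂ν := by
        rw [lintegral_lintegral_swap
          (((hk.comp measurable_snd).mul (hF'.pow_const 2)).aemeasurable)]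
        congr 1
        refine lintegral_congr fun b => lintegral_const_mul _ ?_
        exact (hF.comp measurable_prodMk_left).pow_const 2
    _ ≤ (∫⁻ b, k b ∂ν) * ∫⁻ b, k b * M ∂ν := by
        gcongr with b; exact hM b
    _ = _ := by rw [lintegral_mul_const _ hk]; ring

/-! ### The density -/

/-- The constant `∫ (1 + |v|²)⁻² dv`. -/
def wtConst : ℝ≥0∞ := ∫⁻ v : R3, ENNReal.ofReal (1 / wt v) ^ 2

lemma wtConst_ne_top : wtConst ≠ ⊤ := by
  have h := eLpNorm_two_sq volume (fun v => 1 / wt v)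
  have h2 := ENNReal.pow_ne_top (n := 2) memLp_one_div_wt.eLpNorm_ne_top
  rw [h] at h2
  convert h2 using 1
  unfold wtConst
  refine lintegral_congr fun v => ?_
  rw [Real.enorm_of_nonneg (by have := wt_pos v; positivity)]

/-- Cauchy–Schwarz after inserting `1 = wt⁻¹ · wt`; `wt⁻¹` is square integrable in dimension three.
This is how the weight gives integrability in velocity. -/
lemma sq_lintegral_le_wtConst_mul {f : R3 → ℝ≥0∞} (hf : Measurable f) :
    (∫⁻ v, f v) ^ 2 ≤ wtConst * ∫⁻ v, ENNReal.ofReal (wt v) ^ 2 * f v ^ 2 := by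
  have hw : Measurable wt := continuous_wt.measurable
  have h := lintegral_mul_sq_le (μ := (volume : Measure R3))
    (f := fun v => ENNReal.ofReal (1 / wt v)) (g := fun v => ENNReal.ofReal (wt v) * f v)
    (by fun_prop) (by fun_prop)
  simp only [mul_pow] at h
  refine le_trans (le_of_eq ?_) h
  congr 1
  refine lintegral_congr fun v => ?_
  rw [← mul_assoc, ← ENNReal.ofReal_mul (by have := wt_pos v; positivity),
    one_div, inv_mul_cancel₀ (wt_pos v).ne', ENNReal.ofReal_one, one_mul]

lemma lintegral_sq_lintegral_le {f : R3 × R3 → ℝ≥0∞} (hf : Measurable f) :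
    ∫⁻ x, (∫⁻ v, f (x, v)) ^ 2 ≤
      wtConst * ∫⁻ p : R3 × R3, ENNReal.ofReal (wt p.2) ^ 2 * f p ^ 2 := by
  have hw : Measurable wt := continuous_wt.measurable
  have hm : Measurable (fun p : R3 × R3 => ENNReal.ofReal (wt p.2) ^ 2 * f p ^ 2) := by fun_prop
  calc ∫⁻ x, (∫⁻ v, f (x, v)) ^ 2
      ≤ ∫⁻ x, wtConst * ∫⁻ v, ENNReal.ofReal (wt v) ^ 2 * f (x, v) ^ 2 :=
        lintegral_mono fun x => sq_lintegral_le_wtConst_mul (hf.comp measurable_prodMk_left)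
    _ = _ := by
        rw [lintegral_const_mul _ hm.lintegral_prod_right', Measure.volume_eq_prod,
          lintegral_prod _ hm.aemeasurable]

/-! ### Differences of weakly differentiable functions -/

/-- The segment is run backwards because translations of `G` by `s b` become translations of the
test function by `-s b`. -/
lemma integral_fderiv_segment {H : Type*} [NormedAddCommGroup H] [NormedSpace ℝ H]
    {φ : H → ℝ} (hφ : ContDiff ℝ ∞ φ) (p b : H) :
    ∫ s in (-1 : ℝ)..1, fderiv ℝ φ (p + s • (-b)) b = φ (p + b) - φ (p - b) := by
  have hd : ∀ s : ℝ, HasDerivAt (fun s : ℝ => - φ (p + s • (-b))) (fderiv ℝ φ (p + s • (-b)) b) s := by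
    intro s
    have h1 : HasDerivAt (fun s : ℝ => p + s • (-b)) (-b) s := by
      simpa using ((hasDerivAt_id s).smul_const (-b)).const_add p
    have h2 := ((hφ.differentiable (by simp)) (p + s • (-b))).hasFDerivAt.comp_hasDerivAt s h1
    have h3 := h2.neg
    rw [map_neg, neg_neg] at h3
    exact h3
  rw [intervalIntegral.integral_eq_sub_of_hasDerivAt (fun s _ => hd s)]
  · simp [sub_eq_add_neg]; ring
  · refine Continuous.intervalIntegrable ?_ _ _
    have := hφ.continuous_fderiv (by simp)
    fun_prop

section WeakDerivative

variable {H : Type*} [NormedAddCommGroup H] [NormedSpace ℝ H] [FiniteDimensional ℝ H]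
  [MeasurableSpace H] [BorelSpace H] {μ : Measure H} [μ.IsAddHaarMeasure]

/-- Makes `(s, p) ↦ G (p + s b)` jointly measurable and square integrable although `G` is only
defined almost everywhere, as Fubini along segments requires. -/
lemma measurePreserving_shear (ν : Measure ℝ) [SFinite ν] (b : H) :
    MeasurePreserving (fun q : ℝ × H => (q.1, q.2 + q.1 • b)) (ν.prod μ) (ν.prod μ) := by
  refine (MeasurePreserving.id ν).skew_product (g := fun s p => p + s • b) ?_ ?_
  · exact (continuous_snd.add (continuous_fst.smul continuous_const)).measurable
  · exact Filter.Eventually.of_forall fun s => (measurePreserving_add_right μ (s • b)).map_eq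

lemma memLp_comp_shear {F : Type*} [NormedAddCommGroup F] {G : H → F} (hG : MemLp G 2 μ)
    (ν : Measure ℝ) [IsFiniteMeasure ν] (b : H) :
    MemLp (fun q : ℝ × H => G (q.2 + q.1 • b)) 2 (ν.prod μ) :=
  (hG.comp_snd ν).comp_measurePreserving (measurePreserving_shear ν b)

/-- A function with a weak derivative `G` in the direction `b` is the integral of `G` along almost
every segment in the direction `b`. -/
theorem sub_eq_integral_of_weak_deriv {u G : H → ℝ} (hu : MemLp u 2 μ) (hG : MemLp G 2 μ) (b : H)
    (h : ∀ φ : H → ℝ, ContDiff ℝ ∞ φ → HasCompactSupport φ →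
      ∫ p, u p * fderiv ℝ φ p b ∂μ = - ∫ p, G p * φ p ∂μ) :
    ∀ᵐ p ∂μ, u (p + b) - u (p - b) = ∫ s in (-1 : ℝ)..1, G (p + s • b) := by
  set ν : Measure ℝ := volume.restrict (Set.Ioc (-1) 1) with hν
  have hGs := memLp_comp_shear hG ν b
  have hplus : MemLp (fun p => u (p + b)) 2 μ :=
    hu.comp_measurePreserving (measurePreserving_add_right μ b)
  have hminus : MemLp (fun p => u (p - b)) 2 μ :=
    hu.comp_measurePreserving (measurePreserving_sub_right μ b)
  have hEloc : LocallyIntegrable (fun p => ∫ s, G (p + s • b) ∂ν) μ := by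
    refine (locallyIntegrable_iff).2 fun K hK => ?_
    have : IsFiniteMeasure (μ.restrict K) := ⟨by simpa using hK.measure_lt_top⟩
    have h1 : Integrable (fun q : ℝ × H => G (q.2 + q.1 • b)) (ν.prod (μ.restrict K)) := by
      have : ν.prod (μ.restrict K) = (ν.prod μ).restrict (Set.univ ×ˢ K) := by
        rw [← Measure.prod_restrict, Measure.restrict_univ]
      have h2 : MemLp (fun q : ℝ × H => G (q.2 + q.1 • b)) 2 (ν.prod (μ.restrict K)) := by
        rw [this]; exact hGs.restrict _
      exact h2.integrable (by norm_num)
    exact h1.integral_prod_right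
  have hloc : LocallyIntegrable (fun p => u (p + b) - u (p - b) - ∫ s, G (p + s • b) ∂ν) μ :=
    ((hplus.sub hminus).locallyIntegrable (by norm_num)).sub hEloc
  -- Duality: all translations are moved onto `φ`, for which the segment formula is the fundamental
  -- theorem of calculus.
  have key : ∀ φ : H → ℝ, ContDiff ℝ ∞ φ → HasCompactSupport φ →
      ∫ p, φ p • (u (p + b) - u (p - b) - ∫ s, G (p + s • b) ∂ν) ∂μ = 0 := by
    intro φ hφ hc
    have hφL : MemLp φ 2 μ := hφ.continuous.memLp_of_hasCompactSupport hc
    have hcd : Continuous (fun p => fderiv ℝ φ p b) :=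
      (hφ.continuous_fderiv (by simp)).clm_apply continuous_const
    have hφ'L : MemLp (fun p => fderiv ℝ φ p b) 2 μ :=
      hcd.memLp_of_hasCompactSupport (hc.fderiv_apply (𝕜 := ℝ) b)
    have hi1 : Integrable (fun p => φ p * u (p + b)) μ := hφL.integrable_mul hplus
    have hi2 : Integrable (fun p => φ p * u (p - b)) μ := hφL.integrable_mul hminus
    have hi3 : Integrable (fun q : ℝ × H => φ q.2 * G (q.2 + q.1 • b)) (ν.prod μ) :=
      (hφL.comp_snd ν).integrable_mul hGs
    have hi4 : Integrable (fun q : ℝ × H => u q.2 * fderiv ℝ φ (q.2 + q.1 • (-b)) b) (ν.prod μ) :=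
      (hu.comp_snd ν).integrable_mul (memLp_comp_shear hφ'L ν (-b))
    have e1 : ∫ p, φ p * u (p + b) ∂μ = ∫ p, u p * φ (p - b) ∂μ := by
      rw [← integral_sub_right_eq_self _ b]
      simp [mul_comm]
    have e2 : ∫ p, φ p * u (p - b) ∂μ = ∫ p, u p * φ (p + b) ∂μ := by
      rw [← integral_add_right_eq_self _ b]
      simp [mul_comm]
    have e3 : ∫ p, φ p * ∫ s, G (p + s • b) ∂ν ∂μ
        = - ∫ p, u p * (φ (p + b) - φ (p - b)) ∂μ := by
      calc ∫ p, φ p * ∫ s, G (p + s • b) ∂ν ∂μ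
          = ∫ p, ∫ s, φ p * G (p + s • b) ∂ν ∂μ := by simp_rw [integral_const_mul]
        _ = ∫ s, ∫ p, φ p * G (p + s • b) ∂μ ∂ν := (integral_integral_swap hi3).symm
        _ = ∫ s, - ∫ p, u p * fderiv ℝ φ (p + s • (-b)) b ∂μ ∂ν := by
            refine integral_congr_ae (Filter.Eventually.of_forall fun s => ?_)
            -- The weak derivative is tested against a translate of `φ`, again a test function.
            have h1 := h (fun p => φ (p + s • (-b))) (hφ.comp (contDiff_id.add contDiff_const))
              (hc.comp_homeomorph (Homeomorph.addRight (s • (-b))))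
            simp only [fderiv_comp_add_right] at h1
            simp only [h1, neg_neg]
            rw [← integral_sub_right_eq_self _ (s • b)]
            simp [mul_comm, sub_eq_add_neg]
        _ = - ∫ s, ∫ p, u p * fderiv ℝ φ (p + s • (-b)) b ∂μ ∂ν := integral_neg _
        _ = - ∫ p, ∫ s, u p * fderiv ℝ φ (p + s • (-b)) b ∂ν ∂μ := by
            rw [integral_integral_swap hi4]
        _ = - ∫ p, u p * (φ (p + b) - φ (p - b)) ∂μ := by
            congr 1
            refine integral_congr_ae (Filter.Eventually.of_forall fun p => ?_)
            simp only [integral_const_mul]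
            rw [← integral_fderiv_segment hφ, intervalIntegral.integral_of_le (by norm_num)]
    have hi5 : Integrable (fun p => φ p * ∫ s, G (p + s • b) ∂ν) μ := by
      simp_rw [← integral_const_mul]
      exact hi3.integral_prod_right
    simp only [smul_eq_mul, mul_sub]
    have hi1' : Integrable (fun p => u p * φ (p - b)) μ :=
      hu.integrable_mul (hφL.comp_measurePreserving (measurePreserving_sub_right μ b))
    have hi2' : Integrable (fun p => u p * φ (p + b)) μ :=
      hu.integrable_mul (hφL.comp_measurePreserving (measurePreserving_add_right μ b))
    have hi12 : Integrable (fun p => φ p * u (p + b) - φ p * u (p - b)) μ := hi1.sub hi2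
    rw [integral_sub hi12 hi5, integral_sub hi1 hi2, e1, e2, e3]
    simp only [mul_sub]
    rw [integral_sub hi2' hi1']
    ring
  filter_upwards [ae_eq_zero_of_integral_contDiff_smul_eq_zero hloc key] with p hp
  rw [intervalIntegral.integral_of_le (by norm_num)]
  exact sub_eq_zero.1 hp

end WeakDerivative

instance : (volume : Measure (R3 × R3)).IsAddHaarMeasure := by
  rw [Measure.volume_eq_prod]; infer_instance

/-- Linearity in the direction; the square integrability of `u` and `g` only serves to split the
integrals of sums. -/
lemma IsWeakGradV.weak_deriv {u : R3 × R3 → ℝ} {g : R3 × R3 → R3} (h : IsWeakGradV u g)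
    (hu : MemLp u 2 volume) (hg : MemLp g 2 volume) (a : R3) (φ : R3 × R3 → ℝ)
    (hφ : ContDiff ℝ ∞ φ) (hc : HasCompactSupport φ) :
    ∫ p, u p * fderiv ℝ φ p (0, a) = - ∫ p, inner ℝ (g p) a * φ p := by
  have ha : ((0 : R3), a) = ∑ i, a i • ((0 : R3), EuclideanSpace.single i (1 : ℝ)) := by
    rw [Prod.ext_iff]
    refine ⟨by simp [Prod.fst_sum], ?_⟩
    simp only [Prod.snd_sum, Prod.smul_mk]
    simpa using ((EuclideanSpace.basisFun (Fin 3) ℝ).sum_repr a).symm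
  have hφL : MemLp φ 2 (volume : Measure (R3 × R3)) := hφ.continuous.memLp_of_hasCompactSupport hc
  have hi1 : ∀ b : R3 × R3, Integrable (fun p => u p * fderiv ℝ φ p b) := fun b => by
    have hcd : Continuous (fun p => fderiv ℝ φ p b) :=
      (hφ.continuous_fderiv (by simp)).clm_apply continuous_const
    have hL : MemLp (fun p => fderiv ℝ φ p b) 2 volume :=
      hcd.memLp_of_hasCompactSupport (hc.fderiv_apply (𝕜 := ℝ) b)
    exact hu.integrable_mul hL
  have hi2 : ∀ i : Fin 3, Integrable (fun p => g p i * φ p) := fun i => by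
    have hgi : MemLp (fun p => g p i) 2 (volume : Measure (R3 × R3)) :=
      (EuclideanSpace.proj (𝕜 := ℝ) i).comp_memLp' hg
    exact hgi.integrable_mul hφL
  calc ∫ p, u p * fderiv ℝ φ p (0, a)
      = ∫ p, ∑ i, a i * (u p * fderiv ℝ φ p (0, EuclideanSpace.single i 1)) := by
        refine integral_congr_ae (Filter.Eventually.of_forall fun p => ?_)
        simp only [ha, map_sum, map_smul, smul_eq_mul, Finset.mul_sum]
        exact Finset.sum_congr rfl fun i _ => by ring
    _ = ∑ i, a i * ∫ p, u p * fderiv ℝ φ p (0, EuclideanSpace.single i 1) := by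
        rw [integral_finsetSum _ fun i _ => (hi1 _).const_mul _]
        simp only [integral_const_mul]
    _ = - ∑ i, ∫ p, a i * (g p i * φ p) := by
        rw [← Finset.sum_neg_distrib]
        refine Finset.sum_congr rfl fun i _ => ?_
        rw [h φ hφ hc i, integral_const_mul]; ring
    _ = - ∫ p, ∑ i, a i * (g p i * φ p) := by
        rw [integral_finsetSum _ fun i _ => (hi2 i).const_mul _]
    _ = _ := by
        congr 1
        refine integral_congr_ae (Filter.Eventually.of_forall fun p => ?_)
        simp only [PiLp.inner_apply, Finset.sum_mul]
        exact Finset.sum_congr rfl fun i _ => by simp; ring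

/-- Weighted bound for centred differences in velocity by the velocity gradient. -/
theorem lintegral_weighted_sub_sq_le (u : X) (g : XVec) (h : IsWeakGradV u g) (a : R3) :
    ∫⁻ p : R3 × R3, (ENNReal.ofReal (wt p.2) * ‖u (p.1, p.2 + a) - u (p.1, p.2 - a)‖ₑ) ^ 2 ≤
      ENNReal.ofReal (4 * wt a * ‖a‖) ^ 2 * ENNReal.ofReal ‖g‖ ^ 2 := by
  have hu := memLp_volume_of_weighted (Lp.memLp u)
  have hg := memLp_volume_of_weighted (Lp.memLp g)
  have hG : MemLp (fun p => inner ℝ (g p) a) 2 (volume : Measure (R3 × R3)) :=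
    hg.inner_const a
  have hae := sub_eq_integral_of_weak_deriv hu hG (0, a) (h.weak_deriv hu hg a)
  set ν : Measure ℝ := volume.restrict (Set.Ioc (-1) 1) with hν
  have hgm : Measurable g := (Lp.stronglyMeasurable g).measurable
  have hw : Measurable wt := continuous_wt.measurable
  let F : ℝ → R3 × R3 → ℝ≥0∞ := fun s p =>
    ENNReal.ofReal (wt (p.2 + s • a)) * ‖g (p + s • ((0 : R3), a))‖ₑ
  have hF : Measurable (Function.uncurry F) := by
    simp only [F, Function.uncurry_def]
    have h1 : Measurable (fun q : ℝ × (R3 × R3) => q.2 + q.1 • ((0 : R3), a)) :=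
      (continuous_snd.add (continuous_fst.smul continuous_const)).measurable
    have h2 : Measurable (fun q : ℝ × (R3 × R3) => q.2.2 + q.1 • a) :=
      (by fun_prop : Continuous _).measurable
    exact ((hw.comp h2).ennreal_ofReal).mul (hgm.comp h1).enorm
  have hM : ∀ s, ∫⁻ p, F s p ^ 2 ≤ ENNReal.ofReal ‖g‖ ^ 2 := by
    intro s
    rw [enorm_Lp_weighted_sq, 
      ← lintegral_add_right_eq_self (fun p : R3 × R3 => ENNReal.ofReal (wt p.2) ^ 2 * ‖g p‖ₑ ^ 2)
        (s • ((0 : R3), a))]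
    refine lintegral_mono fun p => le_of_eq ?_
    simp [F, mul_pow]
  -- The factor `2 wt a` comes from moving the weight, `‖a‖` from Cauchy–Schwarz in `inner`, and
  -- another `2` is the length of `[-1, 1]`.
  have hk : ∫⁻ _, ENNReal.ofReal (2 * wt a * ‖a‖) ∂ν = ENNReal.ofReal (4 * wt a * ‖a‖) := by
    have h2 : ν Set.univ = ENNReal.ofReal 2 := by simp [hν]; norm_num
    rw [lintegral_const, h2, ← ENNReal.ofReal_mul (by have := wt_pos a; positivity)]
    ring_nf
  rw [← hk]
  refine le_trans ?_ (lintegral_sq_lintegral_mul_le measurable_const hF hM)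
  refine lintegral_mono_ae ?_
  filter_upwards [hae] with p hp
  gcongr
  have e : u (p.1, p.2 + a) - u (p.1, p.2 - a) = ∫ s, inner ℝ (g (p + s • ((0 : R3), a))) a ∂ν := by
    rw [intervalIntegral.integral_of_le (by norm_num)] at hp
    rw [← hp]
    congr 2
    · ext <;> simp
    · ext <;> simp
  rw [e]
  calc ENNReal.ofReal (wt p.2) * ‖∫ s, inner ℝ (g (p + s • ((0 : R3), a))) a ∂ν‖ₑ
      ≤ ENNReal.ofReal (wt p.2) * ∫⁻ s, ‖(inner ℝ (g (p + s • ((0 : R3), a))) a : ℝ)‖ₑ ∂ν := by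
        gcongr; exact enorm_integral_le_lintegral_enorm _
    _ = ∫⁻ s, ENNReal.ofReal (wt p.2) * ‖(inner ℝ (g (p + s • ((0 : R3), a))) a : ℝ)‖ₑ ∂ν := by
        rw [lintegral_const_mul' _ _ ENNReal.ofReal_ne_top]
    _ ≤ _ := by
        refine setLIntegral_mono' measurableSet_Ioc fun s hs => ?_
        have hs' : |s| ≤ 1 := abs_le.2 ⟨hs.1.le, hs.2⟩
        have h1 : wt p.2 ≤ 2 * wt (p.2 + s • a) * wt a := by
          have h2 := wt_le_mul p.2 (-(s • a))
          rw [sub_neg_eq_add] at h2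
          refine h2.trans ?_
          have h3 : wt (-(s • a)) ≤ wt a := by
            unfold wt
            rw [norm_neg, norm_smul, Real.norm_eq_abs]
            have : |s| * ‖a‖ ≤ ‖a‖ := mul_le_of_le_one_left (norm_nonneg _) hs'
            gcongr
          have := wt_pos (p.2 + s • a)
          gcongr
        have h2 : ‖(inner ℝ (g (p + s • ((0 : R3), a))) a : ℝ)‖ ≤
            ‖g (p + s • ((0 : R3), a))‖ * ‖a‖ := norm_inner_le_norm _ _
        simp only [F]
        have hw0 := wt_pos (p.2 + s • a)
        have hw1 := wt_pos p.2
        have hw2 := wt_pos a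
        rw [← ofReal_norm, ← ofReal_norm, ← ENNReal.ofReal_mul hw1.le, ← ENNReal.ofReal_mul hw0.le,
          ← ENNReal.ofReal_mul (by positivity)]
        refine ENNReal.ofReal_le_ofReal ?_
        calc _ ≤ (2 * wt (p.2 + s • a) * wt a) * (‖g (p + s • ((0 : R3), a))‖ * ‖a‖) := by gcongr
          _ = _ := by ring

/-! ### The main estimate -/

lemma ennreal_add_sq_le (a b : ℝ≥0∞) : (a + b) ^ 2 ≤ 2 * (a ^ 2 + b ^ 2) := by
  have h := ENNReal.rpow_add_le_mul_rpow_add_rpow a b (p := 2) (by norm_num)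
  norm_num at h
  exact_mod_cast h

lemma lintegral_comp_add_smul (f : R3 → ℝ≥0∞) (hf : Measurable f) (v : R3) {c : ℝ} (hc : c ≠ 0) :
    ∫⁻ ξ, f (v + c • ξ) = ENNReal.ofReal |(c ^ 3)⁻¹| * ∫⁻ w, f w := by
  have h1 : Measurable (fun w => f (v + w)) := hf.comp (measurable_const_add v)
  calc ∫⁻ ξ, f (v + c • ξ) = ∫⁻ w, f (v + w) ∂(Measure.map (fun ξ : R3 => c • ξ) volume) :=
        (lintegral_map h1 (measurable_const_smul c)).symm
    _ = _ := by
        rw [Measure.map_addHaar_smul _ hc, lintegral_smul_measure, lintegral_add_left_eq_self]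
        simp

/-- Young's inequality `L² * L¹ → L²`. -/
lemma lintegral_sq_lintegral_mul_comp_le {k f : R3 → ℝ≥0∞} (hk : Measurable k) (hf : Measurable f)
    {c : ℝ} (hc : c ≠ 0) :
    ∫⁻ v, (∫⁻ ξ, k ξ * f (v + c • ξ)) ^ 2 ≤
      ENNReal.ofReal |(c ^ 3)⁻¹| * (∫⁻ v, f v) ^ 2 * ∫⁻ ξ, k ξ ^ 2 := by
  have hm : Measurable (fun q : R3 × R3 => f (q.1 + c • q.2)) :=
    hf.comp (by fun_prop : Continuous _).measurable
  have hkm : Measurable (fun q : R3 × R3 => f (q.1 + c • q.2) * k q.2 ^ 2) :=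
    hm.mul ((hk.comp measurable_snd).pow_const 2)
  calc ∫⁻ v, (∫⁻ ξ, k ξ * f (v + c • ξ)) ^ 2
      ≤ ∫⁻ v, (∫⁻ ξ, f (v + c • ξ)) * ∫⁻ ξ, f (v + c • ξ) * k ξ ^ 2 := by
        refine lintegral_mono fun v => ?_
        simp_rw [mul_comm (k _)]
        exact lintegral_mul_sq_le_lintegral_mul (hm.comp measurable_prodMk_left).aemeasurable
          hk.aemeasurable
    _ = (ENNReal.ofReal |(c ^ 3)⁻¹| * ∫⁻ w, f w) * ∫⁻ v, ∫⁻ ξ, f (v + c • ξ) * k ξ ^ 2 := by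
        simp_rw [lintegral_comp_add_smul f hf _ hc]
        exact lintegral_const_mul _ hkm.lintegral_prod_right'
    _ = (ENNReal.ofReal |(c ^ 3)⁻¹| * ∫⁻ w, f w) * ∫⁻ ξ, (∫⁻ v, f v) * k ξ ^ 2 := by
        rw [lintegral_lintegral_swap hkm.aemeasurable]
        congr 1
        refine lintegral_congr fun ξ => ?_
        have hfm : Measurable (fun v => f (v + c • ξ)) := hf.comp (measurable_add_const _)
        rw [lintegral_mul_const _ hfm, lintegral_add_right_eq_self (fun v => f v)]
    _ = _ := by rw [lintegral_const_mul _ (hk.pow_const 2)]; ring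

lemma measurable_velocity_shift {f : R3 × R3 → ℝ≥0∞} (hf : Measurable f) (c : ℝ) :
    Measurable (fun q : R3 × (R3 × R3) => f (q.2.1, q.2.2 + c • q.1)) :=
  hf.comp (by fun_prop : Continuous _).measurable

/-- Young's inequality in `v` on each fibre, followed by the weighted bound of the `L¹` norm in
velocity. -/
lemma lintegral_sq_lintegral_shift_le {k : R3 → ℝ≥0∞} {f : R3 × R3 → ℝ≥0∞} (hk : Measurable k)
    (hf : Measurable f) {c : ℝ} (hc : c ≠ 0) :
    ∫⁻ p : R3 × R3, (∫⁻ ξ, k ξ * f (p.1, p.2 + c • ξ)) ^ 2 ≤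
      ENNReal.ofReal |(c ^ 3)⁻¹| * wtConst *
        (∫⁻ p : R3 × R3, ENNReal.ofReal (wt p.2) ^ 2 * f p ^ 2) * ∫⁻ ξ, k ξ ^ 2 := by
  have hm : Measurable (fun p : R3 × R3 => ∫⁻ ξ, k ξ * f (p.1, p.2 + c • ξ)) := by
    have h1 : Measurable (fun q : (R3 × R3) × R3 => k q.2 * f (q.1.1, q.1.2 + c • q.2)) :=
      (hk.comp measurable_snd).mul ((measurable_velocity_shift hf c).comp measurable_swap)
    exact h1.lintegral_prod_right'
  rw [Measure.volume_eq_prod, lintegral_prod _ (hm.pow_const 2).aemeasurable]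
  calc ∫⁻ x, ∫⁻ v, (∫⁻ ξ, k ξ * f (x, v + c • ξ)) ^ 2
      ≤ ∫⁻ x, ENNReal.ofReal |(c ^ 3)⁻¹| * (∫⁻ v, f (x, v)) ^ 2 * ∫⁻ ξ, k ξ ^ 2 :=
        lintegral_mono fun x =>
          lintegral_sq_lintegral_mul_comp_le hk (hf.comp measurable_prodMk_left) hc
    _ = ENNReal.ofReal |(c ^ 3)⁻¹| * (∫⁻ x, (∫⁻ v, f (x, v)) ^ 2) * ∫⁻ ξ, k ξ ^ 2 := by
        have h2 : Measurable (fun x => (∫⁻ v, f (x, v)) ^ 2) := hf.lintegral_prod_right'.pow_const 2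
        rw [lintegral_mul_const _ (h2.const_mul _), lintegral_const_mul _ h2]
    _ ≤ ENNReal.ofReal |(c ^ 3)⁻¹| *
          (wtConst * ∫⁻ p : R3 × R3, ENNReal.ofReal (wt p.2) ^ 2 * f p ^ 2) * ∫⁻ ξ, k ξ ^ 2 := by
        gcongr; exact lintegral_sq_lintegral_le hf
    _ = _ := by rw [Measure.volume_eq_prod]; ring

/-- The centred velocity difference `u(x, v + πξ) - u(x, v - πξ)`. -/
def velocityDiff (u : R3 × R3 → ℝ) (p : R3 × R3) (ξ : R3) : ℝ :=
  u (p.1, p.2 + Real.pi • ξ) - u (p.1, p.2 + (-Real.pi) • ξ)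

/-- The part of the weighted difference that is controlled uniformly in `ξ`. -/
def diffMajorant (u : R3 × R3 → ℝ) (ξ : R3) (p : R3 × R3) : ℝ≥0∞ :=
  if ‖ξ‖ < 1 then ENNReal.ofReal (2 / ‖ξ‖) * (ENNReal.ofReal (wt p.2) * ‖velocityDiff u p ξ‖ₑ)
  else 4 * (ENNReal.ofReal (wt (p.2 + Real.pi • ξ)) * ‖u (p.1, p.2 + Real.pi • ξ)‖ₑ +
    ENNReal.ofReal (wt (p.2 + (-Real.pi) • ξ)) * ‖u (p.1, p.2 + (-Real.pi) • ξ)‖ₑ)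

lemma measurable_velocityDiff {u : R3 × R3 → ℝ} (hu : Measurable u) :
    Measurable (fun q : R3 × (R3 × R3) => velocityDiff u q.2 q.1) :=
  (hu.comp (by fun_prop : Continuous fun q : R3 × (R3 × R3) =>
      (q.2.1, q.2.2 + Real.pi • q.1)).measurable).sub
    (hu.comp (by fun_prop : Continuous fun q : R3 × (R3 × R3) =>
      (q.2.1, q.2.2 + (-Real.pi) • q.1)).measurable)

lemma measurable_diffMajorant {u : R3 × R3 → ℝ} (hu : Measurable u) :
    Measurable (Function.uncurry (diffMajorant u)) := by
  have hw : Measurable wt := continuous_wt.measurable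
  have hU : Measurable (fun p : R3 × R3 => ENNReal.ofReal (wt p.2) * ‖u p‖ₑ) :=
    (hw.comp measurable_snd).ennreal_ofReal.mul hu.enorm
  have h1 := (measurable_velocityDiff hu).enorm
  refine Measurable.ite (measurableSet_lt (by fun_prop) measurable_const) ?_ ?_
  · refine Measurable.mul (by fun_prop) (Measurable.mul ?_ h1)
    exact (hw.comp (measurable_snd.comp measurable_snd)).ennreal_ofReal
  · exact ((measurable_velocity_shift hU Real.pi).add
      (measurable_velocity_shift hU (-Real.pi))).const_mul 4

lemma lintegral_weighted_shift (u : R3 × R3 → ℝ) (a : R3) :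
    ∫⁻ p : R3 × R3, (ENNReal.ofReal (wt (p.2 + a)) * ‖u (p.1, p.2 + a)‖ₑ) ^ 2 =
      ∫⁻ p : R3 × R3, ENNReal.ofReal (wt p.2) ^ 2 * ‖u p‖ₑ ^ 2 := by
  rw [← lintegral_add_right_eq_self (fun p : R3 × R3 => ENNReal.ofReal (wt p.2) ^ 2 * ‖u p‖ₑ ^ 2)
    ((0 : R3), a)]
  refine lintegral_congr fun p => ?_
  rw [mul_pow]
  congr 4
  ext <;> simp

/-- For `|ξ| < 1` the factor `2/|ξ|` is absorbed by the increment `π|ξ|` in the gradient bound; for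
`|ξ| ≥ 1` each term is a translate of the weighted `u`. The bound is uniform in `ξ`, as Minkowski's
inequality needs. -/
lemma lintegral_diffMajorant_sq_le (u : X) (g : XVec) (h : IsWeakGradV u g) (ξ : R3) :
    ∫⁻ p, diffMajorant u ξ p ^ 2 ≤
      ENNReal.ofReal (8 * Real.pi * (1 + Real.pi ^ 2)) ^ 2 * ENNReal.ofReal ‖g‖ ^ 2 +
        64 * ENNReal.ofReal ‖u‖ ^ 2 := by
  have hum : Measurable u := (Lp.stronglyMeasurable u).measurable
  have hw : Measurable wt := continuous_wt.measurable
  unfold diffMajorant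
  split_ifs with hξ
  · refine le_trans ?_ le_self_add
    simp_rw [mul_pow (ENNReal.ofReal (2 / ‖ξ‖))]
    rw [lintegral_const_mul' _ _ (ENNReal.pow_ne_top ENNReal.ofReal_ne_top)]
    have h1 := lintegral_weighted_sub_sq_le u g h (Real.pi • ξ)
    have h2 : ∀ p : R3 × R3, velocityDiff u p ξ =
        u (p.1, p.2 + Real.pi • ξ) - u (p.1, p.2 - Real.pi • ξ) := fun p => by
      unfold velocityDiff; rw [neg_smul, sub_eq_add_neg p.2]
    simp_rw [h2]
    refine (mul_le_mul_right h1 _).trans ?_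
    rw [← mul_assoc, ← mul_pow, ← ENNReal.ofReal_mul (by positivity)]
    refine mul_le_mul_left (pow_le_pow_left' (ENNReal.ofReal_le_ofReal ?_) 2) _
    have h3 : wt (Real.pi • ξ) ≤ 1 + Real.pi ^ 2 := by
      unfold wt
      rw [norm_smul, Real.norm_of_nonneg Real.pi_pos.le, mul_pow]
      have : ‖ξ‖ ^ 2 ≤ 1 := pow_le_one₀ (norm_nonneg _) hξ.le
      have := Real.pi_pos
      nlinarith [sq_nonneg Real.pi]
    rw [norm_smul, Real.norm_of_nonneg Real.pi_pos.le]
    rcases eq_or_ne ‖ξ‖ 0 with h0 | h0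
    · rw [h0]; simp only [div_zero, zero_mul]; positivity
    · calc 2 / ‖ξ‖ * (4 * wt (Real.pi • ξ) * (Real.pi * ‖ξ‖)) = 8 * Real.pi * wt (Real.pi • ξ) := by
            field_simp; ring
        _ ≤ _ := by have := Real.pi_pos; gcongr
  · refine le_trans ?_ le_add_self
    have hm : ∀ a : R3, Measurable (fun p : R3 × R3 =>
        (ENNReal.ofReal (wt (p.2 + a)) * ‖u (p.1, p.2 + a)‖ₑ) ^ 2) := fun a => by
      refine ((hw.comp (by fun_prop)).ennreal_ofReal.mul (hum.comp ?_).enorm).pow_const 2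
      exact (by fun_prop : Continuous _).measurable
    calc _ ≤ ∫⁻ p : R3 × R3, 32 *
          ((ENNReal.ofReal (wt (p.2 + Real.pi • ξ)) * ‖u (p.1, p.2 + Real.pi • ξ)‖ₑ) ^ 2 +
          (ENNReal.ofReal (wt (p.2 + (-Real.pi) • ξ)) * ‖u (p.1, p.2 + (-Real.pi) • ξ)‖ₑ) ^ 2) := by
          refine lintegral_mono fun p => ?_
          rw [mul_pow]
          calc _ ≤ (4 : ℝ≥0∞) ^ 2 * (2 * _) := by gcongr; exact ennreal_add_sq_le _ _
            _ = _ := by rw [← mul_assoc]; norm_num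
      _ = 64 * ENNReal.ofReal ‖u‖ ^ 2 := by
          rw [lintegral_const_mul' _ _ (by norm_num), lintegral_add_left (hm _),
            lintegral_weighted_shift, lintegral_weighted_shift, enorm_Lp_weighted_sq, ← two_mul,
            ← mul_assoc]
          norm_num

/-- The heart of the estimate. For small `ξ`, `|ξ|⁻² ≤ (2/|ξ|) · decayKernel ξ`. For large `ξ` the
weight is split additively: one part moves to the shifted velocity with `|ξ|⁻² ≤ 2 decayKernel ξ`,
and the part `2π²|ξ|²` cancels `|ξ|⁻²`, leaving an unweighted shift of `u`. -/
lemma weighted_velocityDiff_le (u : R3 × R3 → ℝ) (p : R3 × R3) (ξ : R3) :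
    ENNReal.ofReal (wt p.2) * (ENNReal.ofReal (1 / ‖ξ‖ ^ 2) * ‖velocityDiff u p ξ‖ₑ) ≤
      ENNReal.ofReal (decayKernel ξ) * diffMajorant u ξ p +
      ENNReal.ofReal (2 * Real.pi ^ 2) * (‖u (p.1, p.2 + Real.pi • ξ)‖ₑ +
        ‖u (p.1, p.2 + (-Real.pi) • ξ)‖ₑ) := by
  have hw := wt_pos p.2
  have hq := decayKernel_nonneg ξ
  rcases eq_or_ne ‖ξ‖ 0 with h0 | h0
  -- At `ξ = 0` the convention `1/0 = 0` makes the left side vanish.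
  · simp [h0]
  have hξ0 : 0 < ‖ξ‖ := lt_of_le_of_ne (norm_nonneg _) h0.symm
  unfold diffMajorant
  split_ifs with hξ
  · refine le_trans ?_ le_self_add
    rw [← mul_assoc, ← mul_assoc, ← mul_assoc, ← ENNReal.ofReal_mul hw.le, ← ENNReal.ofReal_mul hq,
      ← ENNReal.ofReal_mul (by positivity)]
    refine mul_le_mul_left (ENNReal.ofReal_le_ofReal ?_) _
    unfold decayKernel
    calc wt p.2 * (1 / ‖ξ‖ ^ 2) = (1 / ‖ξ‖ ^ 2 * 1) * wt p.2 := by ring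
      _ ≤ (1 / ‖ξ‖ ^ 2 * (2 / (1 + ‖ξ‖))) * wt p.2 := by
          gcongr
          rw [le_div_iff₀ (by positivity)]; linarith
      _ = _ := by field_simp
  · have hξ1 : 1 ≤ ‖ξ‖ := not_lt.1 hξ
    have key : ∀ c : ℝ, c ^ 2 = Real.pi ^ 2 → wt p.2 * (1 / ‖ξ‖ ^ 2) * |u (p.1, p.2 + c • ξ)| ≤
        decayKernel ξ * 4 * (wt (p.2 + c • ξ) * |u (p.1, p.2 + c • ξ)|) +
          2 * Real.pi ^ 2 * |u (p.1, p.2 + c • ξ)| := by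
      intro c hc
      have h1 := wt_le_add p.2 (-(c • ξ))
      rw [sub_neg_eq_add, norm_neg, norm_smul, mul_pow, Real.norm_eq_abs, sq_abs, hc] at h1
      have h2 : 1 / ‖ξ‖ ^ 2 ≤ 2 * decayKernel ξ := by
        unfold decayKernel
        rw [mul_one_div, div_le_div_iff₀ (by positivity) (by positivity)]
        nlinarith
      have h3 := wt_pos (p.2 + c • ξ)
      rw [← mul_assoc, ← add_mul]
      refine mul_le_mul_of_nonneg_right ?_ (abs_nonneg _)
      calc wt p.2 * (1 / ‖ξ‖ ^ 2)
          ≤ (2 * wt (p.2 + c • ξ) + 2 * (Real.pi ^ 2 * ‖ξ‖ ^ 2)) * (1 / ‖ξ‖ ^ 2) := by gcongr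
        _ = 2 * wt (p.2 + c • ξ) * (1 / ‖ξ‖ ^ 2) + 2 * Real.pi ^ 2 := by field_simp
        _ ≤ 2 * wt (p.2 + c • ξ) * (2 * decayKernel ξ) + 2 * Real.pi ^ 2 := by gcongr
        _ = _ := by ring
    have k1 := key Real.pi rfl
    have k2 := key (-Real.pi) (by ring)
    have h4 : ‖velocityDiff u p ξ‖ ≤ |u (p.1, p.2 + Real.pi • ξ)| + |u (p.1, p.2 + (-Real.pi) • ξ)| :=
      abs_sub _ _
    have hw1 := wt_pos (p.2 + Real.pi • ξ)
    have hw2 := wt_pos (p.2 + (-Real.pi) • ξ)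
    have h4' : (4 : ℝ≥0∞) = ENNReal.ofReal 4 := by norm_num
    simp only [← ofReal_norm, Real.norm_eq_abs]
    rw [← mul_assoc, ← ENNReal.ofReal_mul hw.le, h4',
      ← ENNReal.ofReal_mul (by positivity), ← ENNReal.ofReal_mul (by positivity),
      ← ENNReal.ofReal_mul (by positivity), ← ENNReal.ofReal_add (by positivity) (by positivity),
      ← ENNReal.ofReal_mul (by positivity), ← ENNReal.ofReal_mul (by positivity),
      ← ENNReal.ofReal_add (by positivity) (by positivity),
      ← ENNReal.ofReal_mul (by positivity), ← ENNReal.ofReal_add (by positivity) (by positivity)]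
    refine ENNReal.ofReal_le_ofReal ?_
    calc wt p.2 * (1 / ‖ξ‖ ^ 2) * |velocityDiff u p ξ|
        ≤ wt p.2 * (1 / ‖ξ‖ ^ 2) *
          (|u (p.1, p.2 + Real.pi • ξ)| + |u (p.1, p.2 + (-Real.pi) • ξ)|) := by
          gcongr; exact h4
      _ ≤ _ := by rw [mul_add]; linarith

lemma lintegral_mul_decayKernel_sq_le {k : R3 → ℝ≥0∞} (hk : Measurable k) :
    (∫⁻ ξ, k ξ * ENNReal.ofReal (decayKernel ξ)) ^ 2 ≤
      (∫⁻ ξ, k ξ ^ 2) * ∫⁻ ξ, ENNReal.ofReal (decayKernel ξ) ^ 2 :=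
  lintegral_mul_sq_le hk.aemeasurable measurable_decayKernel.ennreal_ofReal.aemeasurable

lemma lintegral_decayKernel_sq_ne_top : ∫⁻ ξ, ENNReal.ofReal (decayKernel ξ) ^ 2 ≠ ⊤ := by
  have h := eLpNorm_two_sq volume decayKernel
  have h2 := ENNReal.pow_ne_top (n := 2) memLp_decayKernel.eLpNorm_ne_top
  rw [h] at h2
  simpa only [Real.enorm_of_nonneg (decayKernel_nonneg _)] using h2

/-- The convolution-type part of the estimate. -/
def decayPart (u : R3 × R3 → ℝ) (k : R3 → ℝ≥0∞) (p : R3 × R3) : ℝ≥0∞ :=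
  ∫⁻ ξ, (k ξ * ENNReal.ofReal (decayKernel ξ)) * diffMajorant u ξ p

/-- The velocity convolution of `k` with `|u|`. -/
def shiftPart (u : R3 × R3 → ℝ) (k : R3 → ℝ≥0∞) (c : ℝ) (p : R3 × R3) : ℝ≥0∞ :=
  ∫⁻ ξ, k ξ * ‖u (p.1, p.2 + c • ξ)‖ₑ

section Parts

variable {u : R3 × R3 → ℝ} {k : R3 → ℝ≥0∞}

lemma measurable_decayPart_integrand (hu : Measurable u) (hk : Measurable k) :
    Measurable (fun q : (R3 × R3) × R3 =>
      (k q.2 * ENNReal.ofReal (decayKernel q.2)) * diffMajorant u q.2 q.1) :=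
by
  have h1 : Measurable (fun ξ => k ξ * ENNReal.ofReal (decayKernel ξ)) :=
    hk.mul measurable_decayKernel.ennreal_ofReal
  have h2 : Measurable (fun q : (R3 × R3) × R3 => k q.2 * ENNReal.ofReal (decayKernel q.2)) :=
    h1.comp measurable_snd
  have hs : Measurable (fun q : (R3 × R3) × R3 => (q.2, q.1)) := measurable_swap
  have h3 := (measurable_diffMajorant hu).comp hs
  exact h2.mul h3

lemma measurable_shiftPart_integrand (hu : Measurable u) (hk : Measurable k) (c : ℝ) :
    Measurable (fun q : (R3 × R3) × R3 => k q.2 * ‖u (q.1.1, q.1.2 + c • q.2)‖ₑ) :=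
  (hk.comp measurable_snd).mul ((measurable_velocity_shift hu.enorm c).comp measurable_swap)

lemma measurable_decayPart (hu : Measurable u) (hk : Measurable k) : Measurable (decayPart u k) :=
  (measurable_decayPart_integrand hu hk).lintegral_prod_right'

lemma measurable_shiftPart (hu : Measurable u) (hk : Measurable k) (c : ℝ) :
    Measurable (shiftPart u k c) :=
  (measurable_shiftPart_integrand hu hk c).lintegral_prod_right'

lemma weighted_lintegral_velocityDiff_le (hu : Measurable u) (hk : Measurable k) (p : R3 × R3) :
    ENNReal.ofReal (wt p.2) *
        ∫⁻ ξ, k ξ * (ENNReal.ofReal (1 / ‖ξ‖ ^ 2) * ‖velocityDiff u p ξ‖ₑ) ≤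
      decayPart u k p + ENNReal.ofReal (2 * Real.pi ^ 2) *
        (shiftPart u k Real.pi p + shiftPart u k (-Real.pi) p) := by
  rw [← lintegral_const_mul' _ _ ENNReal.ofReal_ne_top]
  have m1 : ∀ c, Measurable (fun ξ => k ξ * ‖u (p.1, p.2 + c • ξ)‖ₑ) := fun c =>
    (measurable_shiftPart_integrand hu hk c).comp measurable_prodMk_left
  have m2 : Measurable (fun ξ => (k ξ * ENNReal.ofReal (decayKernel ξ)) * diffMajorant u ξ p) :=
    (measurable_decayPart_integrand hu hk).comp measurable_prodMk_left
  unfold decayPart shiftPart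
  rw [← lintegral_add_left (m1 _), ← lintegral_const_mul' _ _ ENNReal.ofReal_ne_top,
    ← lintegral_add_left m2]
  refine lintegral_mono fun ξ => ?_
  calc ENNReal.ofReal (wt p.2) * (k ξ * (ENNReal.ofReal (1 / ‖ξ‖ ^ 2) * ‖velocityDiff u p ξ‖ₑ))
      = k ξ * (ENNReal.ofReal (wt p.2) *
        (ENNReal.ofReal (1 / ‖ξ‖ ^ 2) * ‖velocityDiff u p ξ‖ₑ)) := by ring
    _ ≤ k ξ * _ := mul_le_mul_right (weighted_velocityDiff_le u p ξ) _
    _ = _ := by ring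

lemma lintegral_sq_sum_le (hu : Measurable u) (hk : Measurable k) {a b : ℝ≥0∞}
    (ha : ∫⁻ p, decayPart u k p ^ 2 ≤ a) (hb : ∫⁻ p, shiftPart u k Real.pi p ^ 2 ≤ b)
    (hb' : ∫⁻ p, shiftPart u k (-Real.pi) p ^ 2 ≤ b) (c : ℝ≥0∞) :
    ∫⁻ p, (decayPart u k p + c * (shiftPart u k Real.pi p + shiftPart u k (-Real.pi) p)) ^ 2 ≤
      2 * (a + c ^ 2 * 4 * b) := by
  have m0 := (measurable_decayPart hu hk).pow_const 2
  have m1 := (measurable_shiftPart hu hk Real.pi).pow_const 2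
  have m2 := (measurable_shiftPart hu hk (-Real.pi)).pow_const 2
  have m12 : Measurable (fun p =>
      shiftPart u k Real.pi p ^ 2 + shiftPart u k (-Real.pi) p ^ 2) := m1.add m2
  calc _ ≤ ∫⁻ p, 2 * (decayPart u k p ^ 2 + c ^ 2 * 2 *
          (shiftPart u k Real.pi p ^ 2 + shiftPart u k (-Real.pi) p ^ 2)) := by
        refine lintegral_mono fun p => (ennreal_add_sq_le _ _).trans ?_
        rw [mul_pow, mul_assoc (_ ^ 2)]
        exact mul_le_mul_right (add_le_add le_rfl (mul_le_mul_right (ennreal_add_sq_le _ _) _)) _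
    _ = 2 * ((∫⁻ p, decayPart u k p ^ 2) + c ^ 2 * 2 *
          ((∫⁻ p, shiftPart u k Real.pi p ^ 2) + ∫⁻ p, shiftPart u k (-Real.pi) p ^ 2)) := by
        rw [lintegral_const_mul' _ _ (by norm_num), lintegral_add_left m0,
          lintegral_const_mul _ m12, lintegral_add_left m1]
    _ ≤ 2 * (a + c ^ 2 * 2 * (b + b)) :=
        mul_le_mul_right (add_le_add ha (mul_le_mul_right (add_le_add hb hb') _)) _
    _ = _ := by ring

end Parts

lemma lintegral_decayPart_sq_le (u : X) (g : XVec) (h : IsWeakGradV u g) {k : R3 → ℝ≥0∞}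
    (hk : Measurable k) :
    ∫⁻ p, decayPart u k p ^ 2 ≤ (∫⁻ ξ, k ξ ^ 2) * (∫⁻ ξ, ENNReal.ofReal (decayKernel ξ) ^ 2) *
      (ENNReal.ofReal (8 * Real.pi * (1 + Real.pi ^ 2)) ^ 2 * ENNReal.ofReal ‖g‖ ^ 2 +
        64 * ENNReal.ofReal ‖u‖ ^ 2) := by
  have hum : Measurable u := (Lp.stronglyMeasurable u).measurable
  refine (lintegral_sq_lintegral_mul_le (hk.mul measurable_decayKernel.ennreal_ofReal)
    (measurable_diffMajorant hum) (lintegral_diffMajorant_sq_le u g h)).trans ?_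
  exact mul_le_mul_left (lintegral_mul_decayKernel_sq_le hk) _

lemma lintegral_shiftPart_sq_le (u : X) {k : R3 → ℝ≥0∞} (hk : Measurable k) {c : ℝ} (hc : c ≠ 0) :
    ∫⁻ p, shiftPart u k c p ^ 2 ≤
      ENNReal.ofReal |(c ^ 3)⁻¹| * wtConst * ENNReal.ofReal ‖u‖ ^ 2 * ∫⁻ ξ, k ξ ^ 2 := by
  rw [enorm_Lp_weighted_sq]
  exact lintegral_sq_lintegral_shift_le hk (Lp.stronglyMeasurable u).measurable.enorm hc

/-- The weighted `L²` estimate for the Wigner operator in its integral form. -/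
theorem exists_lintegral_wigner_sq_le : ∃ C : ℝ≥0∞, C ≠ ⊤ ∧
    ∀ (u : X) (g : XVec), IsWeakGradV u g → ∀ k : R3 → ℝ≥0∞, Measurable k →
      ∫⁻ p : R3 × R3, (ENNReal.ofReal (wt p.2) *
        ∫⁻ ξ, k ξ * (ENNReal.ofReal (1 / ‖ξ‖ ^ 2) * ‖velocityDiff u p ξ‖ₑ)) ^ 2 ≤
      C * (ENNReal.ofReal ‖u‖ ^ 2 + ENNReal.ofReal ‖g‖ ^ 2) * ∫⁻ ξ, k ξ ^ 2 := by
  obtain ⟨Q, hQ⟩ : ∃ Q, Q = ∫⁻ ξ, ENNReal.ofReal (decayKernel ξ) ^ 2 := ⟨_, rfl⟩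
  obtain ⟨A, hA⟩ : ∃ A, A = ENNReal.ofReal (8 * Real.pi * (1 + Real.pi ^ 2)) ^ 2 := ⟨_, rfl⟩
  obtain ⟨D, hD⟩ : ∃ D, D = ENNReal.ofReal (2 * Real.pi ^ 2) := ⟨_, rfl⟩
  obtain ⟨B, hB⟩ : ∃ B, B = ENNReal.ofReal |(Real.pi ^ 3)⁻¹| * wtConst := ⟨_, rfl⟩
  have hQt : Q ≠ ⊤ := hQ ▸ lintegral_decayKernel_sq_ne_top
  have hAt : A ≠ ⊤ := hA ▸ ENNReal.pow_ne_top ENNReal.ofReal_ne_top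
  have hDt : D ^ 2 ≠ ⊤ := hD ▸ ENNReal.pow_ne_top ENNReal.ofReal_ne_top
  have hBt : B ≠ ⊤ := hB ▸ ENNReal.mul_ne_top ENNReal.ofReal_ne_top wtConst_ne_top
  refine ⟨2 * (Q * A + Q * 64 + D ^ 2 * 4 * B), ?_, ?_⟩
  · refine ENNReal.mul_ne_top (by norm_num) (ENNReal.add_ne_top.2 ⟨ENNReal.add_ne_top.2
      ⟨ENNReal.mul_ne_top hQt hAt, ENNReal.mul_ne_top hQt (by norm_num)⟩,
      ENNReal.mul_ne_top (ENNReal.mul_ne_top hDt (by norm_num)) hBt⟩)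
  intro u g h k hk
  have hum : Measurable u := (Lp.stronglyMeasurable u).measurable
  have ha := lintegral_decayPart_sq_le u g h hk
  have hb := lintegral_shiftPart_sq_le u hk Real.pi_ne_zero
  have hb' := lintegral_shiftPart_sq_le u hk (neg_ne_zero.2 Real.pi_ne_zero)
  have hpi : |((-Real.pi) ^ 3)⁻¹| = |(Real.pi ^ 3)⁻¹| := by
    rw [Odd.neg_pow (by decide), inv_neg, abs_neg]
  rw [hpi] at hb'
  rw [← hB] at hb hb'
  rw [← hA, ← hQ] at ha
  have hs := lintegral_sq_sum_le hum hk ha hb hb' D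
  refine le_trans (lintegral_mono fun p =>
    pow_le_pow_left' (weighted_lintegral_velocityDiff_le hum hk p) 2) ?_
  rw [← hD]
  refine hs.trans ?_
  generalize ENNReal.ofReal ‖u‖ ^ 2 = U
  generalize ENNReal.ofReal ‖g‖ ^ 2 = G
  generalize ∫⁻ ξ, k ξ ^ 2 = K
  calc 2 * (K * Q * (A * G + 64 * U) + D ^ 2 * 4 * (B * U * K))
      ≤ 2 * (K * Q * (A * (U + G) + 64 * (U + G)) + D ^ 2 * 4 * (B * (U + G) * K)) := by
        have h1 : U ≤ U + G := le_self_add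
        have h2 : G ≤ U + G := le_add_self
        exact mul_le_mul_right (add_le_add (mul_le_mul_right (add_le_add (mul_le_mul_right h2 _)
          (mul_le_mul_right h1 _)) _) (mul_le_mul_right (mul_le_mul_left
          (mul_le_mul_right h1 _) _) _)) _
    _ = _ := by ring

/-! ### The Fourier transform of the Coulomb kernel -/

/-- Since the kernel is nonnegative, Tonelli turns the absolute double integral into that of `|c
f|`, so integrability of `c f` alone justifies Fubini. -/
lemma integral_integral_nonneg_mul {α β : Type*} {_ : MeasurableSpace α} {_ : MeasurableSpace β}
    {μ : Measure α} {ν : Measure β} [SFinite μ] [SFinite ν] {K : α → β → ℝ}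
    (hK : Measurable (Function.uncurry K)) (hK0 : ∀ b, ∀ᵐ a ∂μ, 0 ≤ K a b) {f : β → ℂ}
    (hf : AEStronglyMeasurable f ν) {c : β → ℝ} (hKi : ∀ᵐ b ∂ν, Integrable (fun a => K a b) μ)
    (hKc : ∀ᵐ b ∂ν, ∫ a, K a b ∂μ = c b) (hcf : Integrable (fun b => (c b : ℂ) * f b) ν) :
    ∫ a, ∫ b, (K a b : ℂ) * f b ∂ν ∂μ = ∫ b, (c b : ℂ) * f b ∂ν := by
  have hm : AEStronglyMeasurable (fun q : α × β => (K q.1 q.2 : ℂ) * f q.2) (μ.prod ν) :=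
    (Complex.measurable_ofReal.comp hK).aestronglyMeasurable.mul hf.comp_snd
  have hi : Integrable (fun q : α × β => (K q.1 q.2 : ℂ) * f q.2) (μ.prod ν) := by
    refine (integrable_prod_iff' hm).2 ⟨?_, ?_⟩
    · filter_upwards [hKi] with b hb
      exact hb.ofReal.mul_const _
    · refine hcf.norm.congr ?_
      filter_upwards [hKc] with b hb
      have : ∫ a, ‖(K a b : ℂ) * f b‖ ∂μ = ∫ a, K a b * ‖f b‖ ∂μ := by
        refine integral_congr_ae ?_
        filter_upwards [hK0 b] with a ha
        rw [norm_mul, Complex.norm_real, Real.norm_of_nonneg ha]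
      rw [this, integral_mul_const, hb, norm_mul, Complex.norm_real, Real.norm_of_nonneg]
      rw [← hb]
      exact integral_nonneg_of_ae (hK0 b)
  rw [integral_integral_swap hi]
  refine integral_congr_ae ?_
  filter_upwards [hKc] with b hb
  rw [integral_mul_const, integral_complex_ofReal, hb]

lemma exists_schwartz_decay (φ : SchwartzMap R3 ℂ) :
    ∃ C : ℝ, 0 ≤ C ∧ ∀ y, (1 + ‖y‖) ^ 3 * ‖φ y‖ ≤ C := by
  have h := fun y => SchwartzMap.one_add_le_sup_seminorm_apply (𝕜 := ℂ) (m := (3, 0)) (k := 3)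
    (n := 0) le_rfl le_rfl φ y
  simp only [norm_iteratedFDeriv_zero] at h
  exact ⟨_, le_trans (by positivity) (h 0), h⟩

lemma integrable_schwartz_div_norm (φ : SchwartzMap R3 ℂ) (x : R3) :
    Integrable (fun y => ((1 / ‖x - y‖ : ℝ) : ℂ) * φ y) := by
  obtain ⟨C, hC0, hC⟩ := exists_schwartz_decay φ
  have hq : Integrable (fun y => decayKernel (x - y) ^ 2) :=
    integrable_decayKernel_sq.comp_sub_left x
  refine (hq.const_mul ((1 + ‖x‖) ^ 3 * C)).mono' ?_ (Filter.Eventually.of_forall fun y => ?_)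
  · exact (Complex.measurable_ofReal.comp (by fun_prop)).aestronglyMeasurable.mul
      φ.continuous.aestronglyMeasurable
  rw [norm_mul, Complex.norm_real, Real.norm_of_nonneg (by positivity)]
  rcases eq_or_ne ‖x - y‖ 0 with h0 | h0
  · rw [h0]; simp; positivity
  have hr : 0 < ‖x - y‖ := lt_of_le_of_ne (norm_nonneg _) h0.symm
  have hxy : 1 + ‖x - y‖ ≤ (1 + ‖x‖) * (1 + ‖y‖) := by
    have := norm_sub_le x y
    nlinarith [norm_nonneg x, norm_nonneg y]
  unfold decayKernel
  calc 1 / ‖x - y‖ * ‖φ y‖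
      = (1 / (‖x - y‖ * (1 + ‖x - y‖))) ^ 2 * (‖x - y‖ * (1 + ‖x - y‖) ^ 2 * ‖φ y‖) := by
        field_simp
    _ ≤ (1 / (‖x - y‖ * (1 + ‖x - y‖))) ^ 2 * (((1 + ‖x‖) * (1 + ‖y‖)) ^ 3 * ‖φ y‖) := by
        refine mul_le_mul_of_nonneg_left (mul_le_mul_of_nonneg_right ?_ (norm_nonneg _))
          (by positivity)
        calc ‖x - y‖ * (1 + ‖x - y‖) ^ 2 ≤ (1 + ‖x - y‖) * (1 + ‖x - y‖) ^ 2 := by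
              gcongr; linarith
          _ = (1 + ‖x - y‖) ^ 3 := by ring
          _ ≤ _ := by gcongr
    _ = (1 / (‖x - y‖ * (1 + ‖x - y‖))) ^ 2 * ((1 + ‖x‖) ^ 3 * ((1 + ‖y‖) ^ 3 * ‖φ y‖)) := by ring
    _ ≤ (1 / (‖x - y‖ * (1 + ‖x - y‖))) ^ 2 * ((1 + ‖x‖) ^ 3 * C) := by gcongr; exact hC y
    _ = _ := by ring

lemma integrable_schwartz_div_norm_sq (φ : SchwartzMap R3 ℂ) :
    Integrable (fun y => ((1 / ‖y‖ ^ 2 : ℝ) : ℂ) * φ y) := by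
  obtain ⟨C, hC0, hC⟩ := exists_schwartz_decay φ
  refine (integrable_decayKernel_sq.const_mul C).mono' ?_ (Filter.Eventually.of_forall fun y => ?_)
  · exact (Complex.measurable_ofReal.comp (by fun_prop)).aestronglyMeasurable.mul
      φ.continuous.aestronglyMeasurable
  rw [norm_mul, Complex.norm_real, Real.norm_of_nonneg (by positivity)]
  rcases eq_or_ne ‖y‖ 0 with h0 | h0
  · rw [h0]; simp; positivity
  have hr : 0 < ‖y‖ := lt_of_le_of_ne (norm_nonneg _) h0.symm
  unfold decayKernel
  calc 1 / ‖y‖ ^ 2 * ‖φ y‖ = (1 / (‖y‖ * (1 + ‖y‖))) ^ 2 * ((1 + ‖y‖) ^ 2 * ‖φ y‖) := by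
        field_simp
    _ ≤ (1 / (‖y‖ * (1 + ‖y‖))) ^ 2 * ((1 + ‖y‖) ^ 3 * ‖φ y‖) := by
        gcongr
        · linarith
        · norm_num
    _ ≤ (1 / (‖y‖ * (1 + ‖y‖))) ^ 2 * C := by gcongr; exact hC y
    _ = _ := by ring

/-- The character `e^{2πi x·ξ}`. -/
def char (x ξ : R3) : ℂ := Complex.exp (2 * Real.pi * Complex.I * (inner ℝ x ξ : ℝ))

lemma continuous_char : Continuous (fun q : R3 × R3 => char q.1 q.2) := by
  unfold char
  fun_prop

lemma norm_char (x ξ : R3) : ‖char x ξ‖ = 1 := by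
  unfold char
  rw [show (2 * Real.pi * Complex.I * (inner ℝ x ξ : ℝ) : ℂ) =
    ((2 * Real.pi * inner ℝ x ξ : ℝ) : ℂ) * Complex.I by push_cast; ring]
  exact Complex.norm_exp_ofReal_mul_I _

/-- The Gaussian whose superposition in `t` is the Coulomb kernel. -/
def gaussianSpace (x : R3) (t : ℝ) (y : R3) : ℝ :=
  Real.pi ^ (3 / 2 : ℝ) * (t ^ (1 / 2 - 1 : ℝ) * Real.exp (-(Real.pi ^ 2 * ‖x - y‖ ^ 2 * t)))

/-- The Gaussian whose superposition in `t` is `1 / |ξ|²`. -/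
def gaussianFreq (t : ℝ) (ξ : R3) : ℝ :=
  t ^ (-1 - 1 : ℝ) * Real.exp (-(‖ξ‖ ^ 2) * t ^ (-1 : ℝ))

/-- The multiplication formula for the modulated Gaussian `e^{-|v|²/t + 2πi x·v}`, whose transform
is again Gaussian. Both kernels carry the normalisation `t⁻²`, removed at the end. -/
lemma integral_gaussianSpace_mul (φ : SchwartzMap R3 ℂ) (x : R3) {t : ℝ} (ht : 0 < t) :
    ∫ y, (gaussianSpace x t y : ℂ) * φ y = ∫ ξ, (gaussianFreq t ξ : ℂ) * (char x ξ * 𝓕 φ ξ) := by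
  have hb : 0 < ((t⁻¹ : ℝ) : ℂ).re := by simpa using ht
  have hγ : Integrable (fun v : R3 => Complex.exp (-((t⁻¹ : ℝ) : ℂ) * (‖v‖ : ℂ) ^ 2 +
      2 * Real.pi * Complex.I * (inner ℝ x v : ℝ))) :=
    GaussianFourier.integrable_cexp_neg_mul_sq_norm_add hb _ x
  have h := VectorFourier.integral_fourierIntegral_smul_eq_flip (L := innerₗ R3)
    Real.continuous_fourierChar continuous_inner hγ (φ.integrable (μ := volume))
  have h1 : ∀ ξ, VectorFourier.fourierIntegral Real.fourierChar volume (innerₗ R3) (fun v : R3 =>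
      Complex.exp (-((t⁻¹ : ℝ) : ℂ) * (‖v‖ : ℂ) ^ 2 +
      2 * Real.pi * Complex.I * (inner ℝ x v : ℝ))) ξ = ((t ^ 2 * gaussianSpace x t ξ : ℝ) : ℂ) := by
    intro ξ
    have h2 := fourier_gaussian_innerProductSpace' hb x ξ
    refine Eq.trans ?_ (h2.trans ?_)
    · rfl
    rw [finrank_euclideanSpace, Fintype.card_fin]
    have e1 : ((Real.pi : ℂ) / ((t⁻¹ : ℝ) : ℂ)) ^ (((3 : ℕ) : ℂ) / 2) =
        (((Real.pi * t) ^ (3 / 2 : ℝ) : ℝ) : ℂ) := by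
      rw [Complex.ofReal_cpow (by positivity)]
      push_cast
      rw [div_inv_eq_mul]
    have e2 : Complex.exp (-(Real.pi : ℂ) ^ 2 * (‖x - ξ‖ : ℂ) ^ 2 / ((t⁻¹ : ℝ) : ℂ)) =
        ((Real.exp (-(Real.pi ^ 2 * ‖x - ξ‖ ^ 2 * t)) : ℝ) : ℂ) := by
      push_cast
      rw [div_inv_eq_mul]
      ring_nf
    rw [e1, e2, ← Complex.ofReal_mul]
    congr 1
    unfold gaussianSpace
    rw [Real.mul_rpow Real.pi_pos.le ht.le]
    have e3 : t ^ (3 / 2 : ℝ) = t ^ 2 * t ^ (1 / 2 - 1 : ℝ) := by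
      rw [← Real.rpow_natCast, ← Real.rpow_add ht]; norm_num
    rw [e3]; ring
  have h3 : ∀ v : R3, Complex.exp (-((t⁻¹ : ℝ) : ℂ) * (‖v‖ : ℂ) ^ 2 +
      2 * Real.pi * Complex.I * (inner ℝ x v : ℝ)) =
      ((t ^ 2 * gaussianFreq t v : ℝ) : ℂ) * char x v := by
    intro v
    unfold gaussianFreq char
    have e3 : t ^ 2 * t ^ (-1 - 1 : ℝ) = 1 := by
      rw [← Real.rpow_natCast, ← Real.rpow_add ht]; norm_num
    rw [← mul_assoc, e3, one_mul, Real.rpow_neg_one, Complex.exp_add]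
    push_cast
    ring_nf
  have h4 : ∀ v : R3, VectorFourier.fourierIntegral Real.fourierChar volume (innerₗ R3).flip φ v
      = 𝓕 φ v := by
    intro v; rw [flip_innerₗ]; rfl
  simp only [h1, h4, smul_eq_mul] at h
  simp only [h3] at h
  have ht2 : ((t ^ 2 : ℝ) : ℂ) ≠ 0 := by exact_mod_cast (pow_pos ht 2).ne'
  refine mul_left_cancel₀ ht2 ?_
  rw [← integral_const_mul, ← integral_const_mul]
  simp only [Complex.ofReal_mul, mul_assoc] at h ⊢
  exact h

lemma integrable_gaussianSpace {x y : R3} (h : x ≠ y) :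
    IntegrableOn (fun t => gaussianSpace x t y) (Set.Ioi 0) ∧
    ∫ t in Set.Ioi 0, gaussianSpace x t y = Real.pi * (1 / ‖x - y‖) := by
  have hr : 0 < ‖x - y‖ := norm_pos_iff.2 (sub_ne_zero.2 h)
  have ha : 0 < Real.pi ^ 2 * ‖x - y‖ ^ 2 := by positivity
  have hv := Real.integral_rpow_mul_exp_neg_mul_Ioi (a := 1 / 2) (by norm_num) ha
  have hval : (1 / (Real.pi ^ 2 * ‖x - y‖ ^ 2)) ^ (1 / 2 : ℝ) * Real.Gamma (1 / 2) =
      (1 / (Real.pi * ‖x - y‖)) * Real.pi ^ (1 / 2 : ℝ) := by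
    rw [Real.Gamma_one_half_eq, Real.sqrt_eq_rpow]
    congr 1
    rw [show 1 / (Real.pi ^ 2 * ‖x - y‖ ^ 2) = (1 / (Real.pi * ‖x - y‖)) ^ 2 by ring,
      ← Real.sqrt_eq_rpow, Real.sqrt_sq (by positivity)]
  constructor
  · have : IntegrableOn (fun t : ℝ => t ^ (1 / 2 - 1 : ℝ) *
        Real.exp (-(Real.pi ^ 2 * ‖x - y‖ ^ 2 * t))) (Set.Ioi 0) := by
      -- The integral has a positive value, whereas a non-integrable function would have integral
      -- `0` by convention.
      by_contra hc
      rw [integral_undef hc, hval] at hv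
      have : 0 < (1 / (Real.pi * ‖x - y‖)) * Real.pi ^ (1 / 2 : ℝ) := by positivity
      linarith
    exact this.const_mul _
  · unfold gaussianSpace
    rw [integral_const_mul, hv, hval]
    have : Real.pi ^ (3 / 2 : ℝ) * Real.pi ^ (1 / 2 : ℝ) = Real.pi ^ 2 := by
      rw [← Real.rpow_add Real.pi_pos, ← Real.rpow_natCast]; norm_num
    calc _ = Real.pi ^ (3 / 2 : ℝ) * Real.pi ^ (1 / 2 : ℝ) * (1 / (Real.pi * ‖x - y‖)) := by ring
      _ = _ := by rw [this]; field_simp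

/-- The substitution `s = 1/t` reduces it to `∫ e^{-|ξ|² s} ds`. -/
lemma integrable_gaussianFreq {ξ : R3} (h : ξ ≠ 0) :
    IntegrableOn (fun t => gaussianFreq t ξ) (Set.Ioi 0) ∧
    ∫ t in Set.Ioi 0, gaussianFreq t ξ = 1 / ‖ξ‖ ^ 2 := by
  have hr : 0 < ‖ξ‖ := norm_pos_iff.2 h
  have ha : -(‖ξ‖ ^ 2) < 0 := by have := pow_pos hr 2; linarith
  have h1 := (integrableOn_Ioi_comp_rpow_iff (fun s => Real.exp (-(‖ξ‖ ^ 2) * s)) (p := -1)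
    (by norm_num)).2 (integrableOn_exp_mul_Ioi ha 0)
  have h2 := integral_comp_rpow_Ioi (fun s => Real.exp (-(‖ξ‖ ^ 2) * s)) (p := -1) (by norm_num)
  rw [integral_exp_mul_Ioi ha] at h2
  simp only [abs_neg, abs_one, one_mul, smul_eq_mul] at h1 h2
  refine ⟨h1, ?_⟩
  unfold gaussianFreq
  rw [h2]
  simp

/-- Integrate the Gaussian identity over `t > 0` and exchange the integrals on both sides; the
superpositions are `π/|x-y|` and `1/|ξ|²`, whence the factor `π⁻¹`. -/
lemma fourier_coulomb_schwartz (φ : SchwartzMap R3 ℂ) (x : R3) :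
    ∫ y, ((1 / ‖x - y‖ : ℝ) : ℂ) * φ y =
      (Real.pi : ℂ)⁻¹ * ∫ ξ, ((1 / ‖ξ‖ ^ 2 : ℝ) : ℂ) * (char x ξ * 𝓕 φ ξ) := by
  have hcx : Continuous (char x) := continuous_char.comp (by fun_prop : Continuous fun ξ => (x, ξ))
  have hms : Measurable (Function.uncurry (gaussianSpace x)) := by
    unfold gaussianSpace Function.uncurry; fun_prop
  have hmf : Measurable (Function.uncurry gaussianFreq) := by
    unfold gaussianFreq Function.uncurry; fun_prop
  have hpos : ∀ᵐ t : ℝ ∂(volume.restrict (Set.Ioi (0 : ℝ))), 0 < t :=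
    ae_restrict_mem measurableSet_Ioi
  have hx : ∀ᵐ y : R3, x ≠ y := by
    filter_upwards [compl_mem_ae_iff.2 (measure_singleton x)] with y hy h using hy h.symm
  have h0 : ∀ᵐ ξ : R3, ξ ≠ 0 := by
    filter_upwards [compl_mem_ae_iff.2 (measure_singleton (0 : R3))] with y hy using hy
  have e1 := integral_integral_nonneg_mul (μ := volume.restrict (Set.Ioi (0 : ℝ))) hms
    (fun y => by filter_upwards [hpos] with t ht; unfold gaussianSpace; positivity)
    φ.continuous.aestronglyMeasurable
    (c := fun y => Real.pi * (1 / ‖x - y‖))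
    (hx.mono fun y hy => (integrable_gaussianSpace hy).1)
    (hx.mono fun y hy => (integrable_gaussianSpace hy).2)
    (by simpa only [Complex.ofReal_mul, mul_assoc] using
      (integrable_schwartz_div_norm φ x).const_mul (Real.pi : ℂ))
  have e2 := integral_integral_nonneg_mul (μ := volume.restrict (Set.Ioi (0 : ℝ))) hmf
    (fun y => by filter_upwards [hpos] with t ht; unfold gaussianFreq; positivity)
    (f := fun ξ => char x ξ * 𝓕 φ ξ)
    (hcx.mul (𝓕 φ).continuous).aestronglyMeasurable
    (c := fun ξ => 1 / ‖ξ‖ ^ 2)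
    (h0.mono fun y hy => (integrable_gaussianFreq hy).1)
    (h0.mono fun y hy => (integrable_gaussianFreq hy).2)
    (by
      refine ((integrable_schwartz_div_norm_sq (𝓕 φ)).bdd_mul (c := 1)
        hcx.aestronglyMeasurable (Filter.Eventually.of_forall fun ξ => (norm_char x ξ).le)).congr
        (Filter.Eventually.of_forall fun ξ => ?_)
      simp only; ring)
  rw [← e2, ← integral_congr_ae (hpos.mono fun t ht => integral_gaussianSpace_mul φ x ht), e1,
    ← integral_const_mul]
  refine integral_congr_ae (Filter.Eventually.of_forall fun y => ?_)
  have : (Real.pi : ℂ) ≠ 0 := by exact_mod_cast Real.pi_ne_zero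
  simp only [Complex.ofReal_mul]
  field_simp

/-- The symbol of the difference of two Coulomb kernels. -/
def coulombSymbol (x₁ x₂ ξ : R3) : ℂ :=
  ((1 / ‖ξ‖ ^ 2 : ℝ) : ℂ) * (char x₁ ξ - char x₂ ξ)

lemma norm_char_sub_le (x₁ x₂ ξ : R3) :
    ‖char x₁ ξ - char x₂ ξ‖ ≤ 2 * Real.pi * ‖x₁ - x₂‖ * ‖ξ‖ := by
  have h1 : char x₁ ξ - char x₂ ξ = char x₂ ξ *
      (Complex.exp (Complex.I * ((2 * Real.pi * inner ℝ (x₁ - x₂) ξ : ℝ) : ℂ)) - 1) := by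
    rw [mul_sub, mul_one]
    congr 1
    unfold char
    rw [← Complex.exp_add, inner_sub_left]
    congr 1
    push_cast
    ring
  rw [h1, norm_mul, norm_char, one_mul]
  refine Real.norm_exp_I_mul_ofReal_sub_one_le.trans ?_
  have h2 : ‖(inner ℝ (x₁ - x₂) ξ : ℝ)‖ ≤ ‖x₁ - x₂‖ * ‖ξ‖ := norm_inner_le_norm _ _
  calc ‖2 * Real.pi * inner ℝ (x₁ - x₂) ξ‖ = 2 * Real.pi * ‖(inner ℝ (x₁ - x₂) ξ : ℝ)‖ := by
        rw [norm_mul, Real.norm_of_nonneg (by have := Real.pi_pos; positivity)]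
    _ ≤ 2 * Real.pi * (‖x₁ - x₂‖ * ‖ξ‖) := by have := Real.pi_pos; gcongr
    _ = _ := by ring

lemma measurable_coulombSymbol (x₁ x₂ : R3) : Measurable (coulombSymbol x₁ x₂) := by
  have hc : ∀ x, Measurable (char x) := fun x =>
    (continuous_char.comp (by fun_prop : Continuous fun ξ => (x, ξ))).measurable
  exact (Complex.measurable_ofReal.comp (by fun_prop)).mul ((hc _).sub (hc _))

/-- Cancellation of the two characters improves `|ξ|⁻²` to `|ξ|⁻¹` at the origin, and at infinity
`|ξ|⁻²` suffices. A single potential would have a symbol that is not square integrable. -/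
lemma memLp_coulombSymbol (x₁ x₂ : R3) : MemLp (coulombSymbol x₁ x₂) 2 volume := by
  refine memLp_decayKernel.of_le_mul (c := 2 * Real.pi * ‖x₁ - x₂‖ + 2)
    (measurable_coulombSymbol x₁ x₂).aestronglyMeasurable (Filter.Eventually.of_forall fun ξ => ?_)
  rw [Real.norm_of_nonneg (decayKernel_nonneg _)]
  unfold coulombSymbol decayKernel
  rw [norm_mul, Complex.norm_real, Real.norm_of_nonneg (by positivity)]
  rcases eq_or_ne ‖ξ‖ 0 with h0 | h0
  · rw [h0]; simp
  have hr : 0 < ‖ξ‖ := lt_of_le_of_ne (norm_nonneg _) h0.symm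
  have h1 := norm_char_sub_le x₁ x₂ ξ
  have h2 : ‖char x₁ ξ - char x₂ ξ‖ ≤ 2 :=
    (norm_sub_le _ _).trans (by rw [norm_char, norm_char]; norm_num)
  rw [one_div_mul_eq_div, mul_one_div, div_le_div_iff₀ (by positivity) (by positivity)]
  nlinarith [mul_le_mul_of_nonneg_left h1 hr.le, mul_le_mul_of_nonneg_left h2 (sq_nonneg ‖ξ‖)]

lemma continuous_integral_mul_Lp {K : R3 → ℂ} (hK : MemLp K 2 volume) :
    Continuous (fun N : Lp ℂ 2 (volume : Measure R3) => ∫ y, K y * N y) := by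
  have hs : MemLp (fun y => star (K y)) 2 volume := hK.star
  have h : (fun N : Lp ℂ 2 (volume : Measure R3) => ∫ y, K y * N y) =
      fun N => inner ℂ (hs.toLp _) N := by
    funext N
    rw [L2.inner_def]
    refine integral_congr_ae ?_
    filter_upwards [hs.coeFn_toLp] with y hy
    rw [hy, RCLike.inner_apply]
    simp [mul_comm]
  rw [h]
  fun_prop

/-- Differences of Newton potentials of `L²` densities in terms of the `L²` Fourier transform. -/
theorem integral_newtonKernel_sub_mul (x₁ x₂ : R3) (N : Lp ℂ 2 (volume : Measure R3)) :
    ∫ y, ((newtonKernel x₁ y - newtonKernel x₂ y : ℝ) : ℂ) * N y =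
      (Real.pi : ℂ)⁻¹ * ∫ ξ, coulombSymbol x₁ x₂ ξ * (𝓕 N : Lp ℂ 2 (volume : Measure R3)) ξ := by
  have hK : MemLp (fun y => ((newtonKernel x₁ y - newtonKernel x₂ y : ℝ) : ℂ)) 2 volume :=
    ((memLp_newtonKernel x₁).sub (memLp_newtonKernel x₂)).ofReal
  have hc1 := continuous_integral_mul_Lp hK
  have hc2 : Continuous (fun N : Lp ℂ 2 (volume : Measure R3) => (Real.pi : ℂ)⁻¹ *
      ∫ ξ, coulombSymbol x₁ x₂ ξ * (𝓕 N : Lp ℂ 2 (volume : Measure R3)) ξ) :=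
    continuous_const.mul ((continuous_integral_mul_Lp (memLp_coulombSymbol x₁ x₂)).comp
      (ContinuousFourier.continuous_fourier))
  -- Both sides are continuous in `N`, so Schwartz functions suffice; there the normalising term
  -- `1/(1+|y|)` cancels in the difference.
  refine congrFun (DenseRange.equalizer
    (SchwartzMap.denseRange_toLpCLM (E := R3) (F := ℂ) (p := 2) (μ := volume)
      ENNReal.ofNat_ne_top) hc1 hc2 ?_) N
  funext φ
  simp only [Function.comp_apply, SchwartzMap.toLpCLM_apply, SchwartzMap.toLp_fourier_eq]
  have e1 : ∫ y, ((newtonKernel x₁ y - newtonKernel x₂ y : ℝ) : ℂ) * (φ.toLp 2 volume) y =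
      (∫ y, ((1 / ‖x₁ - y‖ : ℝ) : ℂ) * φ y) - ∫ y, ((1 / ‖x₂ - y‖ : ℝ) : ℂ) * φ y := by
    rw [← integral_sub (integrable_schwartz_div_norm φ x₁) (integrable_schwartz_div_norm φ x₂)]
    refine integral_congr_ae ?_
    filter_upwards [φ.coeFn_toLp 2 volume] with y hy
    rw [hy]
    unfold newtonKernel
    push_cast
    ring
  have hint : ∀ x, Integrable (fun ξ => ((1 / ‖ξ‖ ^ 2 : ℝ) : ℂ) * (char x ξ * 𝓕 φ ξ)) := fun x => by
    have hcx : Continuous (char x) :=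
      continuous_char.comp (by fun_prop : Continuous fun ξ => (x, ξ))
    refine ((integrable_schwartz_div_norm_sq (𝓕 φ)).bdd_mul (c := 1)
      hcx.aestronglyMeasurable (Filter.Eventually.of_forall fun ξ => (norm_char x ξ).le)).congr
      (Filter.Eventually.of_forall fun ξ => ?_)
    simp only; ring
  rw [e1, fourier_coulomb_schwartz, fourier_coulomb_schwartz, ← mul_sub,
    ← integral_sub (hint _) (hint _)]
  congr 1
  refine integral_congr_ae ?_
  filter_upwards [(𝓕 φ).coeFn_toLp 2 volume] with ξ hξ
  rw [hξ]
  unfold coulombSymbol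
  ring

/-! ### The `L²` Fourier transform on `L¹ ∩ L²` -/

/-- On `L¹ ∩ L²` the `L²` Fourier transform is given by the Fourier integral. -/
theorem fourier_toLp_ae_eq {f : R3 → ℂ} (hf1 : Integrable f) (hf2 : MemLp f 2 volume) :
    (𝓕 (hf2.toLp f) : Lp ℂ 2 (volume : Measure R3)) =ᵐ[volume] 𝓕 f := by
  have hcont : Continuous (𝓕 f) :=
    VectorFourier.fourierIntegral_continuous Real.continuous_fourierChar
      (L := innerₗ R3) continuous_inner hf1
  have hL : LocallyIntegrable (𝓕 (hf2.toLp f) : Lp ℂ 2 (volume : Measure R3)) volume :=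
    (Lp.memLp _).locallyIntegrable (by norm_num)
  -- Tested against `ψ`, both transforms give `∫ (𝓕 ψ) f`: one through tempered distributions, the
  -- other by Fubini.
  have h := ae_eq_zero_of_integral_contDiff_smul_eq_zero (hL.sub hcont.locallyIntegrable) ?_
  · filter_upwards [h] with ξ hξ
    exact sub_eq_zero.1 hξ
  intro φ hφ hc
  have hφc : ContDiff ℝ ∞ (fun x => (φ x : ℂ)) := Complex.ofRealCLM.contDiff.comp hφ
  have hcc : HasCompactSupport (fun x => (φ x : ℂ)) := hc.comp_left Complex.ofReal_zero
  let ψ : SchwartzMap R3 ℂ := hcc.toSchwartzMap hφc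
  have hψ : ∀ x, ψ x = (φ x : ℂ) := fun x => rfl
  have e1 : ∫ ξ, ψ ξ • (𝓕 (hf2.toLp f) : Lp ℂ 2 (volume : Measure R3)) ξ =
      ∫ ξ, (𝓕 ψ) ξ • f ξ := by
    have h1 := congrArg (fun T => T ψ) (Lp.fourier_toTemperedDistribution_eq (hf2.toLp f))
    simp only [TemperedDistribution.fourier_apply, Lp.toTemperedDistribution_apply] at h1
    rw [← h1]
    refine integral_congr_ae ?_
    filter_upwards [hf2.coeFn_toLp] with ξ hξ
    rw [hξ]
  have e2 : ∫ ξ, (𝓕 ψ) ξ • f ξ = ∫ ξ, ψ ξ • 𝓕 f ξ := by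
    have h2 := VectorFourier.integral_fourierIntegral_smul_eq_flip (L := innerₗ R3)
      Real.continuous_fourierChar continuous_inner (ψ.integrable (μ := volume)) hf1
    rw [flip_innerₗ] at h2
    exact h2
  have hφL : MemLp (fun x => (φ x : ℂ)) 2 (volume : Measure R3) :=
    hφc.continuous.memLp_of_hasCompactSupport hcc
  have i1 : Integrable (fun ξ => ψ ξ • (𝓕 (hf2.toLp f) : Lp ℂ 2 (volume : Measure R3)) ξ) :=
    hφL.integrable_mul (Lp.memLp (𝓕 (hf2.toLp f) : Lp ℂ 2 (volume : Measure R3)))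
  have i2 : Integrable (fun ξ => ψ ξ • 𝓕 f ξ) :=
    (hφc.continuous.smul hcont).integrable_of_hasCompactSupport hcc.smul_right
  calc ∫ ξ, φ ξ • ((𝓕 (hf2.toLp f) : Lp ℂ 2 (volume : Measure R3)) ξ - 𝓕 f ξ)
      = ∫ ξ, (ψ ξ • (𝓕 (hf2.toLp f) : Lp ℂ 2 (volume : Measure R3)) ξ - ψ ξ • 𝓕 f ξ) := by
        refine integral_congr_ae (Filter.Eventually.of_forall fun ξ => ?_)
        simp only [hψ, smul_sub, Complex.real_smul, smul_eq_mul]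
    _ = 0 := by rw [integral_sub i1 i2, e1, e2, sub_self]

lemma memLp_fourier {f : R3 → ℂ} (hf1 : Integrable f) (hf2 : MemLp f 2 volume) :
    MemLp (𝓕 f) 2 volume :=
  (memLp_congr_ae (fourier_toLp_ae_eq hf1 hf2)).1 (Lp.memLp _)

lemma toLp_fourier_eq {f : R3 → ℂ} (hf1 : Integrable f) (hf2 : MemLp f 2 volume)
    (h : MemLp (𝓕 f) 2 volume) : h.toLp (𝓕 f) = 𝓕 (hf2.toLp f) := by
  refine Lp.ext ?_
  exact h.coeFn_toLp.trans (fourier_toLp_ae_eq hf1 hf2).symm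

lemma fourierInv_toLp_fourier {f : R3 → ℂ} (hf1 : Integrable f) (hf2 : MemLp f 2 volume)
    (h : MemLp (𝓕 f) 2 volume) :
    (𝓕⁻ (h.toLp (𝓕 f)) : Lp ℂ 2 (volume : Measure R3)) =ᵐ[volume] f := by
  rw [toLp_fourier_eq hf1 hf2, FourierTransform.fourierInv_fourier_eq]
  exact hf2.coeFn_toLp

/-- A function in `L¹ ∩ L²` whose Fourier transform is Hermitian is real. -/
lemma im_ae_eq_zero_of_fourier_hermitian {f : R3 → ℂ} (hf1 : Integrable f)
    (hf2 : MemLp f 2 volume) (h : ∀ η, 𝓕 f (-η) = star (𝓕 f η)) : ∀ᵐ v, (f v).im = 0 := by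
  have hs1 : Integrable (fun v => star (f v)) :=
    memLp_one_iff_integrable.1 (memLp_one_iff_integrable.2 hf1).star
  have hs2 : MemLp (fun v => star (f v)) 2 volume := hf2.star
  -- The Hermitian symmetry says that `f` and its conjugate have the same transform; injectivity on
  -- `L²` then identifies them.
  have e : 𝓕 (fun v => star (f v)) = 𝓕 f := by
    funext η
    have h1 : 𝓕 (fun v => star (f v)) η = star (𝓕 f (-η)) := by
      rw [Real.fourier_eq', Real.fourier_eq']
      change _ = (starRingEnd ℂ) _
      rw [← integral_conj]
      refine integral_congr_ae (Filter.Eventually.of_forall fun v => ?_)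
      simp only [smul_eq_mul, map_mul, ← Complex.exp_conj, inner_neg_right, Complex.conj_ofReal,
        Complex.conj_I]
      congr 2
      push_cast
      ring
    rw [h1, h, star_star]
  have hL : hs2.toLp _ = hf2.toLp f := by
    have h1 := toLp_fourier_eq hs1 hs2 (memLp_fourier hs1 hs2)
    have h2 := toLp_fourier_eq hf1 hf2 (memLp_fourier hf1 hf2)
    have h3 : 𝓕 (hs2.toLp _) = 𝓕 (hf2.toLp f) := by
      rw [← h1, ← h2]; congr 1
    have h4 := congrArg (𝓕⁻ ·) h3
    simpa only [FourierTransform.fourierInv_fourier_eq] using h4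
  have h5 : (fun v => star (f v)) =ᵐ[volume] f :=
    hs2.coeFn_toLp.symm.trans ((by rw [hL] : (hs2.toLp _ : R3 → ℂ) =ᵐ[volume] hf2.toLp f).trans
      hf2.coeFn_toLp)
  filter_upwards [h5] with v hv
  exact Complex.conj_eq_iff_im.1 hv

/-! ### The density of a state -/

lemma lintegral_lintegral_weighted_lt_top (z : X) :
    ∫⁻ x, (∫⁻ v, ‖z (x, v)‖ₑ) ^ 2 < ⊤ := by
  refine (lintegral_sq_lintegral_le (Lp.stronglyMeasurable z).measurable.enorm).trans_lt ?_
  rw [← enorm_Lp_weighted_sq]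
  exact ENNReal.mul_lt_top wtConst_ne_top.lt_top (ENNReal.pow_lt_top ENNReal.ofReal_lt_top)

lemma ae_integrable_velocity (z : X) : ∀ᵐ x : R3, Integrable (fun v => z (x, v)) := by
  have hz := Lp.stronglyMeasurable z
  have hm : Measurable (fun x : R3 => (∫⁻ v, ‖z (x, v)‖ₑ) ^ 2) :=
    hz.measurable.enorm.lintegral_prod_right'.pow_const 2
  filter_upwards [ae_lt_top hm (lintegral_lintegral_weighted_lt_top z).ne] with x hx
  refine ⟨(hz.comp_measurable measurable_prodMk_left).aestronglyMeasurable, ?_⟩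
  exact (ENNReal.pow_lt_top_iff.1 hx).resolve_right (by norm_num)

lemma eLpNorm_density_sq_le (z : X) :
    eLpNorm (density z) 2 volume ^ 2 ≤ wtConst * ENNReal.ofReal ‖z‖ ^ 2 := by
  rw [eLpNorm_two_sq, enorm_Lp_weighted_sq]
  refine le_trans (lintegral_mono fun x => ?_)
    (lintegral_sq_lintegral_le (Lp.stronglyMeasurable z).measurable.enorm)
  exact pow_le_pow_left' (enorm_integral_le_lintegral_enorm _) 2

lemma memLp_density (z : X) : MemLp (density z) 2 volume := by
  refine ⟨?_, ?_⟩
  · exact (Lp.stronglyMeasurable z).integral_prod_right'.aestronglyMeasurable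
  · have h : eLpNorm (density z) 2 volume ^ 2 < ⊤ := (eLpNorm_density_sq_le z).trans_lt
      (ENNReal.mul_lt_top wtConst_ne_top.lt_top (ENNReal.pow_lt_top ENNReal.ofReal_lt_top))
    exact (ENNReal.pow_lt_top_iff.1 h).resolve_right (by norm_num)

lemma integrable_newtonKernel_mul_density (z : X) (x : R3) :
    Integrable (fun y => newtonKernel x y * density z y) :=
  (memLp_newtonKernel x).integrable_mul (memLp_density z)

lemma density_congr_ae {f g : R3 × R3 → ℝ} (h : f =ᵐ[volume] g) :
    density f =ᵐ[volume] density g := by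
  rw [Measure.volume_eq_prod] at h
  filter_upwards [Measure.ae_ae_of_ae_prod h] with x hx
  exact integral_congr_ae hx

lemma density_add (z₁ z₂ : X) :
    density (z₁ + z₂ : X) =ᵐ[volume] fun x => density z₁ x + density z₂ x := by
  refine (density_congr_ae (volume_ac_weightedMeasure.ae_eq (Lp.coeFn_add z₁ z₂))).trans ?_
  filter_upwards [ae_integrable_velocity z₁, ae_integrable_velocity z₂] with x h1 h2
  exact integral_add h1 h2

lemma density_smul (c : ℝ) (z : X) :
    density (c • z : X) =ᵐ[volume] fun x => c * density z x := by
  refine (density_congr_ae (volume_ac_weightedMeasure.ae_eq (Lp.coeFn_smul c z))).trans ?_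
  exact Filter.Eventually.of_forall fun x => integral_const_mul _ _

/-- The density as an element of the complex `L²` space. -/
def densityLp (z : X) : Lp ℂ 2 (volume : Measure R3) :=
  (memLp_density z).ofReal.toLp (fun x => ((density z x : ℝ) : ℂ))

lemma coeFn_densityLp (z : X) : densityLp z =ᵐ[volume] fun x => ((density z x : ℝ) : ℂ) :=
  MemLp.coeFn_toLp _

/-- Plancherel, then the weighted bound on the density. -/
lemma enorm_densityLp_sq_le (z : X) :
    ∫⁻ ξ, ‖(𝓕 (densityLp z) : Lp ℂ 2 (volume : Measure R3)) ξ‖ₑ ^ 2 ≤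
      wtConst * ENNReal.ofReal ‖z‖ ^ 2 := by
  refine le_trans (le_of_eq ?_) (eLpNorm_density_sq_le z)
  rw [← eLpNorm_two_sq]
  congr 1
  rw [← ENNReal.ofReal_toReal (Lp.eLpNorm_ne_top _), ← Lp.norm_def, Lp.norm_fourier_eq,
    Lp.norm_def, ENNReal.ofReal_toReal (Lp.eLpNorm_ne_top _), eLpNorm_congr_ae (coeFn_densityLp z)]
  refine eLpNorm_congr_norm_ae (Filter.Eventually.of_forall fun x => ?_)
  simp

lemma fourier_densityLp_add (z₁ z₂ : X) :
    𝓕 (densityLp (z₁ + z₂)) = 𝓕 (densityLp z₁) + 𝓕 (densityLp z₂) := by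
  rw [← FourierTransform.fourier_add]
  congr 1
  refine Lp.ext ?_
  filter_upwards [coeFn_densityLp (z₁ + z₂), coeFn_densityLp z₁, coeFn_densityLp z₂,
    Lp.coeFn_add (densityLp z₁) (densityLp z₂), density_add z₁ z₂] with x h h1 h2 h3 h4
  rw [h, h3, Pi.add_apply, h1, h2, h4]
  push_cast; ring

lemma fourier_densityLp_smul (c : ℝ) (z : X) :
    𝓕 (densityLp (c • z)) = (c : ℂ) • 𝓕 (densityLp z) := by
  rw [← FourierTransform.fourier_smul]
  congr 1
  refine Lp.ext ?_
  filter_upwards [coeFn_densityLp (c • z), coeFn_densityLp z,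
    Lp.coeFn_smul (c : ℂ) (densityLp z), density_smul c z] with x h h1 h3 h4
  rw [h, h3, Pi.smul_apply, h1, h4, smul_eq_mul]
  push_cast; ring

/-! ### The Wigner operator as an integral over frequencies -/

/-- The integrand of `wignerIntegral`. -/
def wignerIntegrand (u : R3 × R3 → ℝ) (m : R3 → ℂ) (p : R3 × R3) (ξ : R3) : ℂ :=
  m ξ * (((1 / ‖ξ‖ ^ 2 : ℝ) : ℂ) * char p.1 ξ * (velocityDiff u p ξ : ℂ))

/-- `Θ[V]u` for the potential `V` of a density with Fourier transform `m`. -/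
def wignerIntegral (u : R3 × R3 → ℝ) (m : R3 → ℂ) (p : R3 × R3) : ℂ :=
  -(Complex.I / (4 * Real.pi ^ 2)) * ∫ ξ, wignerIntegrand u m p ξ

/-- The absolute version of `wignerIntegral`. -/
def wignerMajorant (u : R3 × R3 → ℝ) (m : R3 → ℂ) (p : R3 × R3) : ℝ≥0∞ :=
  ∫⁻ ξ, ‖m ξ‖ₑ * (ENNReal.ofReal (1 / ‖ξ‖ ^ 2) * ‖velocityDiff u p ξ‖ₑ)

lemma enorm_char (x ξ : R3) : ‖char x ξ‖ₑ = 1 := by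
  rw [← ofReal_norm, norm_char, ENNReal.ofReal_one]

lemma enorm_wignerIntegrand (u : R3 × R3 → ℝ) (m : R3 → ℂ) (p : R3 × R3) (ξ : R3) :
    ‖wignerIntegrand u m p ξ‖ₑ =
      ‖m ξ‖ₑ * (ENNReal.ofReal (1 / ‖ξ‖ ^ 2) * ‖velocityDiff u p ξ‖ₑ) := by
  unfold wignerIntegrand
  have h1 : ∀ r : ℝ, ‖(r : ℂ)‖ₑ = ‖r‖ₑ := fun r => by
    rw [← ofReal_norm, ← ofReal_norm, Complex.norm_real]
  rw [enorm_mul, enorm_mul, enorm_mul, enorm_char, mul_one, h1, h1,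
    Real.enorm_of_nonneg (by positivity)]

lemma enorm_wignerIntegral_le (u : R3 × R3 → ℝ) (m : R3 → ℂ) (p : R3 × R3) :
    ‖wignerIntegral u m p‖ₑ ≤ wignerMajorant u m p := by
  unfold wignerIntegral wignerMajorant
  simp_rw [← enorm_wignerIntegrand]
  rw [enorm_mul]
  -- The prefactor `1/(4π²)` is at most `1` and is discarded.
  refine (mul_le_mul' ?_ (enorm_integral_le_lintegral_enorm _)).trans (one_mul _).le
  rw [← ofReal_norm, ← ENNReal.ofReal_one]
  refine ENNReal.ofReal_le_ofReal ?_
  rw [norm_neg, norm_div, Complex.norm_I]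
  have h3 := Real.pi_gt_three
  have : ‖(4 * Real.pi ^ 2 : ℂ)‖ = 4 * Real.pi ^ 2 := by
    rw [norm_mul, norm_pow, Complex.norm_real, Real.norm_of_nonneg Real.pi_pos.le]; norm_num
  rw [this]
  refine div_le_one_of_le₀ ?_ (by positivity)
  nlinarith

section Measurability

variable {u : R3 × R3 → ℝ} {m : R3 → ℂ}

lemma measurable_wignerIntegrand (hu : Measurable u) (hm : Measurable m) :
    Measurable (fun q : (R3 × R3) × R3 => wignerIntegrand u m q.1 q.2) := by
  have hs : Measurable (fun q : (R3 × R3) × R3 => (q.2, q.1)) := measurable_swap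
  have h1 := (measurable_velocityDiff hu).comp hs
  have h2 : Measurable (fun q : (R3 × R3) × R3 => char q.1.1 q.2) :=
    (continuous_char.comp (by fun_prop : Continuous fun q : (R3 × R3) × R3 => (q.1.1, q.2))).measurable
  have h3 : Measurable (fun q : (R3 × R3) × R3 => ((1 / ‖q.2‖ ^ 2 : ℝ) : ℂ)) :=
    Complex.measurable_ofReal.comp (by fun_prop)
  exact (hm.comp measurable_snd).mul ((h3.mul h2).mul (Complex.measurable_ofReal.comp h1))

lemma measurable_wignerMajorant (hu : Measurable u) (hm : Measurable m) :
    Measurable (wignerMajorant u m) := by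
  have h := (measurable_wignerIntegrand hu hm).enorm
  simp_rw [enorm_wignerIntegrand] at h
  exact h.lintegral_prod_right'

lemma stronglyMeasurable_wignerIntegral (hu : Measurable u) (hm : Measurable m) :
    StronglyMeasurable (wignerIntegral u m) :=
  (measurable_wignerIntegrand hu hm).stronglyMeasurable.integral_prod_right'.const_mul _

lemma integrable_wignerIntegrand (hu : Measurable u) (hm : Measurable m) {p : R3 × R3}
    (h : wignerMajorant u m p < ⊤) : Integrable (wignerIntegrand u m p) := by
  refine ⟨((measurable_wignerIntegrand hu hm).comp
    (measurable_prodMk_left (x := p))).aestronglyMeasurable, ?_⟩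
  unfold HasFiniteIntegral
  simp_rw [enorm_wignerIntegrand]
  exact h

end Measurability

/-- The oscillation `e^{-iv·η}`. -/
def osc (η v : R3) : ℂ := Complex.exp (-(Complex.I * ((inner ℝ v η : ℝ) : ℂ)))

lemma continuous_osc (η : R3) : Continuous (osc η) := by unfold osc; fun_prop

lemma norm_osc (η v : R3) : ‖osc η v‖ = 1 := by
  unfold osc
  rw [show -(Complex.I * ((inner ℝ v η : ℝ) : ℂ)) = ((-(inner ℝ v η : ℝ) : ℝ) : ℂ) * Complex.I by
    push_cast; ring]
  exact Complex.norm_exp_ofReal_mul_I _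

lemma osc_add (η v w : R3) : osc η (v + w) = osc η v * osc η w := by
  unfold osc
  rw [← Complex.exp_add, inner_add_left]
  push_cast; ring_nf

lemma osc_mul_osc_neg (η v : R3) : osc η v * osc η (-v) = 1 := by
  rw [← osc_add]; simp [osc]

lemma integral_shift_mul_osc (f : R3 → ℝ) (η a : R3) :
    ∫ v, (f (v + a) : ℂ) * osc η v = osc η (-a) * ∫ v, (f v : ℂ) * osc η v := by
  rw [← integral_const_mul, ← integral_add_right_eq_self
    (fun v => osc η (-a) * ((f v : ℂ) * osc η v)) a]
  refine integral_congr_ae (Filter.Eventually.of_forall fun v => ?_)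
  simp only [osc_add]
  linear_combination (-(f (v + a) : ℂ) * osc η v) * osc_mul_osc_neg η a

lemma integrable_mul_osc {f : R3 → ℂ} (hf : Integrable f) (η : R3) :
    Integrable (fun v => f v * osc η v) :=
  hf.mul_bdd (c := 1) (continuous_osc η).aestronglyMeasurable
    (Filter.Eventually.of_forall fun v => (norm_osc η v).le)

lemma integral_velocityDiff_mul_osc {u : R3 × R3 → ℝ} {x : R3}
    (hu : Integrable (fun v => u (x, v))) (η ξ : R3) :
    ∫ v, (velocityDiff u (x, v) ξ : ℂ) * osc η v =
      (osc η (-(Real.pi • ξ)) - osc η (Real.pi • ξ)) * ∫ v, (u (x, v) : ℂ) * osc η v := by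
  have hi : ∀ a : R3, Integrable (fun v => (u (x, v + a) : ℂ) * osc η v) := fun a =>
    integrable_mul_osc (hu.comp_add_right a).ofReal η
  have e := fun a : R3 => integral_shift_mul_osc (fun v => u (x, v)) η a
  unfold velocityDiff
  simp only [Complex.ofReal_sub, sub_mul]
  rw [integral_sub (hi _) (hi _), e, e]
  simp

/-- The half shift in `x` at angular frequency `2πξ` equals the multiplier of the velocity shift by
`πξ`; hence the `π` in `velocityDiff`. -/
lemma char_add_half (x η ξ : R3) :
    char (x + (1 / 2 : ℝ) • η) ξ = char x ξ * osc η (-(Real.pi • ξ)) := by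
  unfold char osc
  rw [← Complex.exp_add, inner_add_left, inner_neg_left, real_inner_smul_left,
    real_inner_smul_left, real_inner_comm η ξ]
  push_cast; ring_nf

lemma char_sub_half (x η ξ : R3) :
    char (x - (1 / 2 : ℝ) • η) ξ = char x ξ * osc η (Real.pi • ξ) := by
  unfold char osc
  rw [← Complex.exp_add, inner_sub_left, real_inner_smul_left,
    real_inner_smul_left, real_inner_comm η ξ]
  push_cast; ring_nf

/-- The symbol `δV` of the potential of a state, through the Fourier transform of its density. -/
lemma delta_newtonPotential_eq (z : X) (x η : R3) :
    (delta (newtonPotential (density z)) x η : ℂ) = -(1 / (4 * Real.pi ^ 2)) *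
      ∫ ξ, coulombSymbol (x + (1 / 2 : ℝ) • η) (x - (1 / 2 : ℝ) • η) ξ *
        (𝓕 (densityLp z) : Lp ℂ 2 (volume : Measure R3)) ξ := by
  have h := integral_newtonKernel_sub_mul (x + (1 / 2 : ℝ) • η) (x - (1 / 2 : ℝ) • η) (densityLp z)
  have h1 : ∫ y, ((newtonKernel (x + (1 / 2 : ℝ) • η) y - newtonKernel (x - (1 / 2 : ℝ) • η) y : ℝ)
      : ℂ) * densityLp z y = ((∫ y, newtonKernel (x + (1 / 2 : ℝ) • η) y * density z y -
        newtonKernel (x - (1 / 2 : ℝ) • η) y * density z y : ℝ) : ℂ) := by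
    rw [← integral_complex_ofReal]
    refine integral_congr_ae ?_
    filter_upwards [coeFn_densityLp z] with y hy
    rw [hy]
    push_cast; ring
  rw [h1, integral_sub (integrable_newtonKernel_mul_density z _)
    (integrable_newtonKernel_mul_density z _)] at h
  have hpi : (Real.pi : ℂ) ≠ 0 := by exact_mod_cast Real.pi_ne_zero
  have h2 : (∫ ξ, coulombSymbol (x + (1 / 2 : ℝ) • η) (x - (1 / 2 : ℝ) • η) ξ *
        (𝓕 (densityLp z) : Lp ℂ 2 (volume : Measure R3)) ξ) = Real.pi *
      ((∫ y, newtonKernel (x + (1 / 2 : ℝ) • η) y * density z y) -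
        ∫ y, newtonKernel (x - (1 / 2 : ℝ) • η) y * density z y : ℝ) := by
    rw [h]; field_simp
  rw [h2]
  unfold delta newtonPotential
  push_cast
  field_simp
  ring

/-- Fourier transform of the frequency integral in velocity. -/
lemma integral_wignerIntegral_mul_osc {u : R3 × R3 → ℝ} (hum : Measurable u) (z : X) {x : R3}
    (hu : Integrable (fun v => u (x, v)))
    (hG : ∫⁻ v, wignerMajorant u (𝓕 (densityLp z) : Lp ℂ 2 (volume : Measure R3)) (x, v) < ⊤)
    (η : R3) :
    ∫ v, wignerIntegral u (𝓕 (densityLp z) : Lp ℂ 2 (volume : Measure R3)) (x, v) * osc η v =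
      Complex.I * (delta (newtonPotential (density z)) x η : ℂ) *
        ∫ v, (u (x, v) : ℂ) * osc η v := by
  obtain ⟨m, hm⟩ : ∃ m : R3 → ℂ, m = (𝓕 (densityLp z) : Lp ℂ 2 (volume : Measure R3)) := ⟨_, rfl⟩
  have hmm : Measurable m := by rw [hm]; exact (Lp.stronglyMeasurable _).measurable
  rw [delta_newtonPotential_eq, ← hm]
  rw [← hm] at hG
  have hmeas : Measurable (fun q : R3 × R3 => wignerIntegrand u m (x, q.1) q.2) :=
    (measurable_wignerIntegrand hum hmm).comp
      (by fun_prop : Continuous fun q : R3 × R3 => ((x, q.1), q.2)).measurable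
  have hint0 : Integrable (fun q : R3 × R3 => wignerIntegrand u m (x, q.1) q.2)
      ((volume : Measure R3).prod volume) := by
    refine ⟨hmeas.aestronglyMeasurable, ?_⟩
    unfold HasFiniteIntegral
    rw [lintegral_prod _ hmeas.enorm.aemeasurable]
    simp_rw [enorm_wignerIntegrand]
    exact hG
  -- The finite majorant on the fibre is the absolute integrability in `(v, ξ)` that Fubini needs.
  have hint : Integrable (fun q : R3 × R3 => wignerIntegrand u m (x, q.1) q.2 * osc η q.1)
      ((volume : Measure R3).prod volume) :=
    hint0.mul_bdd (c := 1) ((continuous_osc η).comp continuous_fst).aestronglyMeasurable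
      (Filter.Eventually.of_forall fun q => (norm_osc η q.1).le)
  have e1 : ∫ v, wignerIntegral u m (x, v) * osc η v =
      -(Complex.I / (4 * Real.pi ^ 2)) * ∫ ξ, ∫ v, wignerIntegrand u m (x, v) ξ * osc η v := by
    rw [← integral_integral_swap hint, ← integral_const_mul]
    refine integral_congr_ae (Filter.Eventually.of_forall fun v => ?_)
    simp only [wignerIntegral, integral_mul_const, mul_assoc]
  have e2 : ∀ ξ, ∫ v, wignerIntegrand u m (x, v) ξ * osc η v =
      coulombSymbol (x + (1 / 2 : ℝ) • η) (x - (1 / 2 : ℝ) • η) ξ * m ξ *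
        ∫ v, (u (x, v) : ℂ) * osc η v := by
    intro ξ
    have e3 : ∀ v, wignerIntegrand u m (x, v) ξ * osc η v = (m ξ * (((1 / ‖ξ‖ ^ 2 : ℝ) : ℂ) *
        char x ξ)) * ((velocityDiff u (x, v) ξ : ℂ) * osc η v) := fun v => by
      unfold wignerIntegrand; ring
    simp_rw [e3]
    rw [integral_const_mul, integral_velocityDiff_mul_osc hu]
    unfold coulombSymbol
    rw [char_add_half, char_sub_half]
    ring
  rw [e1]
  simp_rw [e2]
  rw [integral_mul_const]
  ring

/-! ### Identification of the Wigner operator -/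

lemma fourierV_eq (u : R3 × R3 → ℝ) (x η : R3) :
    fourierV u x η = (((2 * Real.pi) ^ (-(3 / 2) : ℝ) : ℝ) : ℂ) * ∫ v, (u (x, v) : ℂ) * osc η v :=
  rfl

/-- The Fourier transform of a dilated function in terms of `e^{-iv·η}`. -/
lemma fourier_dilation (f : R3 → ℂ) (η : R3) :
    𝓕 (fun v => (((2 * Real.pi) ^ (3 / 2 : ℝ) : ℝ) : ℂ) * f ((2 * Real.pi) • v)) η =
      (((2 * Real.pi) ^ (-(3 / 2) : ℝ) : ℝ) : ℂ) * ∫ v, f v * osc η v := by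
  have hpi : 0 < 2 * Real.pi := by positivity
  have h1 := Measure.integral_comp_smul (volume : Measure R3)
    (fun v => (((2 * Real.pi) ^ (3 / 2 : ℝ) : ℝ) : ℂ) * (f v * osc η v)) (2 * Real.pi)
  rw [Real.fourier_eq']
  have h2 : ∀ v : R3, Complex.exp (((-2 * Real.pi * inner ℝ v η : ℝ) : ℂ) * Complex.I) •
      ((((2 * Real.pi) ^ (3 / 2 : ℝ) : ℝ) : ℂ) * f ((2 * Real.pi) • v)) =
      (((2 * Real.pi) ^ (3 / 2 : ℝ) : ℝ) : ℂ) *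
        (f ((2 * Real.pi) • v) * osc η ((2 * Real.pi) • v)) := by
    intro v
    unfold osc
    rw [real_inner_smul_left, smul_eq_mul]
    have : (((-2 * Real.pi * inner ℝ v η : ℝ) : ℂ) * Complex.I) =
      -(Complex.I * ((2 * Real.pi * inner ℝ v η : ℝ) : ℂ)) := by push_cast; ring
    rw [this]; ring
  simp_rw [h2]
  rw [h1, integral_const_mul, finrank_euclideanSpace, Fintype.card_fin,
    abs_of_pos (by positivity), Complex.real_smul, ← mul_assoc, ← Complex.ofReal_mul]
  congr 2
  rw [← Real.rpow_natCast, ← Real.rpow_neg hpi.le, ← Real.rpow_add hpi]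
  norm_num

lemma osc_neg_left (η v : R3) : osc (-η) v = star (osc η v) := by
  unfold osc
  change _ = (starRingEnd ℂ) _
  rw [← Complex.exp_conj, inner_neg_right]
  simp

lemma fourierV_neg (u : R3 × R3 → ℝ) (x η : R3) : fourierV u x (-η) = star (fourierV u x η) := by
  rw [fourierV_eq, fourierV_eq]
  change _ = (starRingEnd ℂ) _
  rw [map_mul, Complex.conj_ofReal, ← integral_conj]
  congr 1
  refine integral_congr_ae (Filter.Eventually.of_forall fun v => ?_)
  simp only [map_mul, Complex.conj_ofReal, osc_neg_left]
  rfl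

lemma delta_neg (V : R3 → ℝ) (x η : R3) : delta V x (-η) = -delta V x η := by
  unfold delta
  rw [smul_neg, sub_neg_eq_add, ← sub_eq_add_neg]
  ring

/-- If the velocity transform of a function in `L¹ ∩ L²` is the symbol of the Wigner operator, then
the function is real and is the inverse transform of the symbol. -/
lemma wigner_fiber {V : R3 → ℝ} {u : R3 × R3 → ℝ} {x : R3} {W : R3 → ℂ} (hW1 : Integrable W)
    (hW2 : MemLp W 2 volume)
    (h : ∀ η, ∫ v, W v * osc η v = Complex.I * (delta V x η : ℂ) * ∫ v, (u (x, v) : ℂ) * osc η v) :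
    ∃ hm : MemLp (fun η : R3 => Complex.I * (delta V x η : ℂ) * fourierV u x η) 2 volume,
      ∀ᵐ v : R3, ((W v).re : ℂ) = fourierInvL2 (hm.toLp _) v := by
  have hpi : 0 < 2 * Real.pi := by positivity
  -- The dilation that converts `(2π)^{-3/2} ∫ · e^{-iv·η}` into the unitary transform with phase
  -- `e^{-2πi v·η}`.
  set f : R3 → ℂ := fun v => (((2 * Real.pi) ^ (3 / 2 : ℝ) : ℝ) : ℂ) * W ((2 * Real.pi) • v)
    with hf
  have hdil : AEStronglyMeasurable (fun v => W ((2 * Real.pi) • v)) volume :=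
    hW1.1.comp_quasiMeasurePreserving (Measure.quasiMeasurePreserving_smul volume hpi.ne')
  have hf1 : Integrable f := (hW1.comp_smul hpi.ne').const_mul _
  have hf2 : MemLp f 2 volume := by
    refine MemLp.const_mul ?_ _
    have h1 := (memLp_two_iff_integrable_sq_norm hW2.1).1 hW2
    exact (memLp_two_iff_integrable_sq_norm hdil).2 (h1.comp_smul hpi.ne')
  have hF : 𝓕 f = fun η : R3 => Complex.I * (delta V x η : ℂ) * fourierV u x η := by
    funext η
    rw [hf, fourier_dilation, h, fourierV_eq]
    ring
  have hm := memLp_fourier hf1 hf2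
  -- `δV` is real and odd in `η`, so `i δV` is Hermitian, as is the transform of the real function
  -- `u`.
  have hherm : ∀ η, 𝓕 f (-η) = star (𝓕 f η) := by
    intro η
    rw [hF]
    simp only [delta_neg, fourierV_neg, star_mul']
    simp
  have him := im_ae_eq_zero_of_fourier_hermitian hf1 hf2 hherm
  have hinv := fourierInv_toLp_fourier hf1 hf2 hm
  have hqm : Measure.QuasiMeasurePreserving (fun v : R3 => (2 * Real.pi)⁻¹ • v) volume volume :=
    Measure.quasiMeasurePreserving_smul volume (inv_ne_zero hpi.ne')
  have key : ∀ᵐ v : R3, ((W v).re : ℂ) = fourierInvL2 (hm.toLp _) v := by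
    filter_upwards [hqm.ae him, hqm.ae hinv] with v h1 h2
    unfold fourierInvL2
    have e1 : (((2 * Real.pi) ^ (-(3 / 2) : ℝ) : ℝ) : ℂ) *
        (((2 * Real.pi) ^ (3 / 2 : ℝ) : ℝ) : ℂ) = 1 := by
      rw [← Complex.ofReal_mul, ← Real.rpow_add hpi]; norm_num
    have e2 : f ((2 * Real.pi)⁻¹ • v) = (((2 * Real.pi) ^ (3 / 2 : ℝ) : ℝ) : ℂ) * W v := by
      rw [hf]; simp only [smul_inv_smul₀ hpi.ne']
    rw [h2, e2, ← mul_assoc, e1, one_mul]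
    rw [e2, Complex.im_ofReal_mul] at h1
    have h3 : (W v).im = 0 := (mul_eq_zero.1 h1).resolve_left (by positivity)
    exact Complex.ext (by simp) (by simp [h3])
  revert hm
  rw [hF]
  intro hm _ key
  exact ⟨hm, key⟩

/-! ### The operator on the state space -/

section State

variable (u z : X)

/-- The Fourier transform of the density of a state. -/
abbrev densityHat (z : X) : R3 → ℂ := (𝓕 (densityLp z) : Lp ℂ 2 (volume : Measure R3))

lemma measurable_densityHat : Measurable (densityHat z) := (Lp.stronglyMeasurable _).measurable

lemma measurable_majorant : Measurable (wignerMajorant u (densityHat z)) :=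
  measurable_wignerMajorant (Lp.stronglyMeasurable u).measurable (measurable_densityHat z)

variable {u}

/-- The squared weighted norm of the majorant. -/
def majorantSq (u z : X) : ℝ≥0∞ :=
  ∫⁻ p : R3 × R3, ENNReal.ofReal (wt p.2) ^ 2 * wignerMajorant u (densityHat z) p ^ 2

lemma majorantSq_le {C : ℝ≥0∞} (hC : ∀ k : R3 → ℝ≥0∞, Measurable k →
      ∫⁻ p : R3 × R3, (ENNReal.ofReal (wt p.2) *
        ∫⁻ ξ, k ξ * (ENNReal.ofReal (1 / ‖ξ‖ ^ 2) * ‖velocityDiff u p ξ‖ₑ)) ^ 2 ≤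
      C * ∫⁻ ξ, k ξ ^ 2) :
    majorantSq u z ≤ C * (wtConst * ENNReal.ofReal ‖z‖ ^ 2) := by
  have h := hC (fun ξ => ‖densityHat z ξ‖ₑ) (measurable_densityHat z).enorm
  simp only [mul_pow] at h
  exact h.trans (mul_le_mul_right (enorm_densityLp_sq_le z) _)

variable {z}

/-- The weight makes almost every fibre of the majorant integrable; with the square integrability
below, fibres lie in `L¹ ∩ L²`, where Fourier inversion is available. -/
lemma ae_lintegral_majorant_lt_top (hfin : majorantSq u z < ⊤) :
    ∀ᵐ x : R3, ∫⁻ v, wignerMajorant u (densityHat z) (x, v) < ⊤ := by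
  have hm := measurable_majorant u z
  have h := (lintegral_sq_lintegral_le hm).trans_lt (ENNReal.mul_lt_top wtConst_ne_top.lt_top hfin)
  filter_upwards [ae_lt_top (hm.lintegral_prod_right'.pow_const 2) h.ne] with x hx
  exact (ENNReal.pow_lt_top_iff.1 hx).resolve_right (by norm_num)

lemma ae_lintegral_majorant_sq_lt_top (hfin : majorantSq u z < ⊤) :
    ∀ᵐ x : R3, ∫⁻ v, wignerMajorant u (densityHat z) (x, v) ^ 2 < ⊤ := by
  have hm := (measurable_majorant u z).pow_const 2
  have h : ∫⁻ x : R3, ∫⁻ v, wignerMajorant u (densityHat z) (x, v) ^ 2 < ⊤ := by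
    rw [← lintegral_prod _ hm.aemeasurable, ← Measure.volume_eq_prod]
    refine lt_of_le_of_lt (lintegral_mono fun p => ?_) hfin
    refine le_mul_of_one_le_left' (one_le_pow₀ ?_)
    simpa using ENNReal.ofReal_le_ofReal (one_le_wt p.2)
  exact ae_lt_top hm.lintegral_prod_right' h.ne

lemma ae_majorant_lt_top (hfin : majorantSq u z < ⊤) : ∀ᵐ p : R3 × R3, wignerMajorant u (densityHat z) p < ⊤ := by
  have hm := (measurable_majorant u z).pow_const 2
  have h : ∫⁻ p, wignerMajorant u (densityHat z) p ^ 2 < ⊤ := by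
    refine lt_of_le_of_lt (lintegral_mono fun p => ?_) hfin
    refine le_mul_of_one_le_left' (one_le_pow₀ ?_)
    simpa using ENNReal.ofReal_le_ofReal (one_le_wt p.2)
  filter_upwards [ae_lt_top hm h.ne] with p hp
  exact (ENNReal.pow_lt_top_iff.1 hp).resolve_right (by norm_num)

lemma isWignerOp_wignerIntegral (hfin : majorantSq u z < ⊤) {w : X}
    (hw : w =ᵐ[weightedMeasure] fun p => (wignerIntegral u (densityHat z) p).re) :
    IsWignerOp (newtonPotential (density z)) u w := by
  have hum : Measurable u := (Lp.stronglyMeasurable u).measurable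
  have hWm := stronglyMeasurable_wignerIntegral hum (measurable_densityHat z)
  have hw' := volume_ac_weightedMeasure.ae_eq hw
  rw [Measure.volume_eq_prod] at hw'
  filter_upwards [ae_integrable_velocity u, ae_lintegral_majorant_lt_top hfin,
    ae_lintegral_majorant_sq_lt_top hfin, Measure.ae_ae_of_ae_prod hw'] with x h1 h2 h3 h4
  refine ⟨h1, ?_⟩
  have hWx : AEStronglyMeasurable (fun v => wignerIntegral u (densityHat z) (x, v)) volume :=
    (hWm.comp_measurable measurable_prodMk_left).aestronglyMeasurable
  have hW1 : Integrable (fun v => wignerIntegral u (densityHat z) (x, v)) :=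
    ⟨hWx, (lintegral_mono fun v => enorm_wignerIntegral_le _ _ _).trans_lt h2⟩
  have hW2 : MemLp (fun v => wignerIntegral u (densityHat z) (x, v)) 2 volume := by
    refine ⟨hWx, ?_⟩
    have h5 : eLpNorm (fun v => wignerIntegral u (densityHat z) (x, v)) 2 volume ^ 2 < ⊤ := by
      rw [eLpNorm_two_sq]
      exact (lintegral_mono fun v => pow_le_pow_left' (enorm_wignerIntegral_le _ _ _) 2).trans_lt h3
    exact (ENNReal.pow_lt_top_iff.1 h5).resolve_right (by norm_num)
  obtain ⟨hm, hv⟩ := wigner_fiber (V := newtonPotential (density z)) (u := u) (x := x) hW1 hW2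
    (integral_wignerIntegral_mul_osc hum z h1 h2)
  refine ⟨hm, ?_⟩
  filter_upwards [hv, h4] with v h5 h6
  rw [← h5, h6]

lemma eLpNorm_wignerIntegral_re_sq_le (u z : X) :
    eLpNorm (fun p => (wignerIntegral u (densityHat z) p).re) 2 weightedMeasure ^ 2 ≤
      majorantSq u z := by
  have hWm := stronglyMeasurable_wignerIntegral (Lp.stronglyMeasurable u).measurable
    (measurable_densityHat z)
  rw [eLpNorm_weighted_sq _ (Complex.continuous_re.comp_stronglyMeasurable hWm).aestronglyMeasurable]
  refine lintegral_mono fun p => mul_le_mul_right (pow_le_pow_left' ?_ 2) _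
  refine le_trans ?_ (enorm_wignerIntegral_le _ _ _)
  rw [← ofReal_norm, ← ofReal_norm]
  exact ENNReal.ofReal_le_ofReal (Complex.abs_re_le_norm _)

lemma memLp_wignerIntegral_re (hfin : majorantSq u z < ⊤) :
    MemLp (fun p => (wignerIntegral u (densityHat z) p).re) 2 weightedMeasure := by
  have hWm := stronglyMeasurable_wignerIntegral (Lp.stronglyMeasurable u).measurable
    (measurable_densityHat z)
  refine ⟨(Complex.continuous_re.comp_stronglyMeasurable hWm).aestronglyMeasurable, ?_⟩
  have h := (eLpNorm_wignerIntegral_re_sq_le u z).trans_lt hfin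
  exact (ENNReal.pow_lt_top_iff.1 h).resolve_right (by norm_num)

end State

/-- Additivity needs both frequency integrals to converge, which holds where the majorants are
finite, thus almost everywhere. Homogeneity below needs no convergence and holds at every point. -/
lemma wignerIntegral_densityHat_add (u : X) {z₁ z₂ : X} (h₁ : majorantSq u z₁ < ⊤)
    (h₂ : majorantSq u z₂ < ⊤) :
    ∀ᵐ p : R3 × R3, wignerIntegral u (densityHat (z₁ + z₂)) p =
      wignerIntegral u (densityHat z₁) p + wignerIntegral u (densityHat z₂) p := by
  have hum : Measurable u := (Lp.stronglyMeasurable u).measurable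
  have hm : densityHat (z₁ + z₂) =ᵐ[volume] fun ξ => densityHat z₁ ξ + densityHat z₂ ξ := by
    unfold densityHat
    rw [fourier_densityLp_add]
    exact Lp.coeFn_add _ _
  filter_upwards [ae_majorant_lt_top h₁, ae_majorant_lt_top h₂] with p hp1 hp2
  unfold wignerIntegral
  rw [← mul_add, ← integral_add (integrable_wignerIntegrand hum (measurable_densityHat z₁) hp1)
    (integrable_wignerIntegrand hum (measurable_densityHat z₂) hp2)]
  congr 1
  refine integral_congr_ae ?_
  filter_upwards [hm] with ξ hξ
  simp only [wignerIntegrand, hξ, add_mul]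

lemma wignerIntegral_densityHat_smul (u : X) (c : ℝ) (z : X) (p : R3 × R3) :
    wignerIntegral u (densityHat (c • z)) p = c * wignerIntegral u (densityHat z) p := by
  have hm : densityHat (c • z) =ᵐ[volume] fun ξ => (c : ℂ) * densityHat z ξ := by
    unfold densityHat
    rw [fourier_densityLp_smul]
    exact Lp.coeFn_smul (c : ℂ) (𝓕 (densityLp z) : Lp ℂ 2 (volume : Measure R3))
  unfold wignerIntegral
  rw [← mul_assoc, mul_comm (c : ℂ), mul_assoc]
  congr 1
  rw [← integral_const_mul (c : ℂ)]
  refine integral_congr_ae ?_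
  filter_upwards [hm] with ξ hξ
  simp only [wignerIntegrand, hξ, mul_assoc]

/-- The linear map `z ↦ Θ[V[z]]u`. -/
def wignerLinearMap (u : X) (hfin : ∀ z : X, majorantSq u z < ⊤) : X →ₗ[ℝ] X where
  toFun z := (memLp_wignerIntegral_re (hfin z)).toLp _
  map_add' z₁ z₂ := by
    refine Lp.ext ?_
    filter_upwards [(memLp_wignerIntegral_re (hfin (z₁ + z₂))).coeFn_toLp,
      (memLp_wignerIntegral_re (hfin z₁)).coeFn_toLp, (memLp_wignerIntegral_re (hfin z₂)).coeFn_toLp,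
      Lp.coeFn_add ((memLp_wignerIntegral_re (hfin z₁)).toLp _)
        ((memLp_wignerIntegral_re (hfin z₂)).toLp _),
      weightedMeasure_ac_volume.ae_le (wignerIntegral_densityHat_add u (hfin z₁) (hfin z₂))]
      with p h h1 h2 h3 h4
    rw [h, h3, Pi.add_apply, h1, h2, h4, Complex.add_re]
  map_smul' c z := by
    refine Lp.ext ?_
    filter_upwards [(memLp_wignerIntegral_re (hfin (c • z))).coeFn_toLp,
      (memLp_wignerIntegral_re (hfin z)).coeFn_toLp,
      Lp.coeFn_smul c ((memLp_wignerIntegral_re (hfin z)).toLp _)] with p h h1 h3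
    rw [h, RingHom.id_apply, h3, Pi.smul_apply, h1, wignerIntegral_densityHat_smul,
      Complex.re_ofReal_mul, smul_eq_mul]

lemma isWignerOp_wignerLinearMap (u : X) (hfin : ∀ z : X, majorantSq u z < ⊤) (z : X) :
    IsWignerOp (newtonPotential (density z)) u (wignerLinearMap u hfin z) :=
  isWignerOp_wignerIntegral (hfin z) (memLp_wignerIntegral_re (hfin z)).coeFn_toLp

lemma norm_wignerLinearMap_sq_le (u : X) (hfin : ∀ z : X, majorantSq u z < ⊤) (z : X) :
    ENNReal.ofReal ‖wignerLinearMap u hfin z‖ ^ 2 ≤ majorantSq u z := by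
  refine le_trans (le_of_eq ?_) (eLpNorm_wignerIntegral_re_sq_le u z)
  change ENNReal.ofReal ‖(memLp_wignerIntegral_re (hfin z)).toLp _‖ ^ 2 = _
  rw [Lp.norm_toLp, ENNReal.ofReal_toReal (memLp_wignerIntegral_re (hfin z)).eLpNorm_ne_top]

lemma le_of_ofReal_sq_le {t a b c : ℝ} {K : ℝ≥0∞} (hK : K ≠ ⊤) (ha : 0 ≤ a) (hb : 0 ≤ b)
    (hc : 0 ≤ c)
    (h : ENNReal.ofReal t ^ 2 ≤ K * (ENNReal.ofReal a ^ 2 + ENNReal.ofReal b ^ 2) *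
      ENNReal.ofReal c ^ 2) : t ≤ √K.toReal * (a + b) * c := by
  rcases le_total t 0 with ht | ht
  · exact ht.trans (by positivity)
  obtain ⟨r, hr0, rfl⟩ : ∃ r : ℝ, 0 ≤ r ∧ K = ENNReal.ofReal r :=
    ⟨K.toReal, ENNReal.toReal_nonneg, (ENNReal.ofReal_toReal hK).symm⟩
  rw [ENNReal.toReal_ofReal hr0]
  rw [← ENNReal.ofReal_pow ht, ← ENNReal.ofReal_pow ha, ← ENNReal.ofReal_pow hb,
    ← ENNReal.ofReal_pow hc, ← ENNReal.ofReal_add (by positivity) (by positivity),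
    ← ENNReal.ofReal_mul hr0, ← ENNReal.ofReal_mul (by positivity),
    ENNReal.ofReal_le_ofReal_iff (by positivity)] at h
  refine abs_le_of_sq_le_sq' ?_ (by positivity) |>.2
  calc t ^ 2 ≤ r * (a ^ 2 + b ^ 2) * c ^ 2 := h
    _ ≤ r * (a + b) ^ 2 * c ^ 2 := by gcongr; nlinarith [mul_nonneg ha hb]
    _ = _ := by rw [mul_pow, mul_pow, Real.sq_sqrt hr0]

end WPFP

end

theorem proposition2p4 :
    -- the density and the Newton potential are well defined on `X`
    (∀ z : WPFP.X,
      (∀ᵐ x : WPFP.R3, Integrable (fun v => z (x, v))) ∧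
      MemLp (WPFP.density z) 2 volume ∧
      ∀ x : WPFP.R3, Integrable (fun y => WPFP.newtonKernel x y * WPFP.density z y)) ∧
    -- `z ↦ Θ[V[z]]u` is a bounded linear operator on `X`, with the stated bound
    ∃ C : ℝ, ∀ (u : WPFP.X) (g : WPFP.XVec), WPFP.IsWeakGradV u g →
      ∃ T : WPFP.X →L[ℝ] WPFP.X, ∀ z : WPFP.X,
        WPFP.IsWignerOp (WPFP.newtonPotential (WPFP.density z)) u (T z) ∧
        ‖T z‖ ≤ C * (‖u‖ + ‖g‖) * ‖z‖ := by
  refine ⟨fun z => ⟨WPFP.ae_integrable_velocity z, WPFP.memLp_density z,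
    WPFP.integrable_newtonKernel_mul_density z⟩, ?_⟩
  obtain ⟨C, hCt, hC⟩ := WPFP.exists_lintegral_wigner_sq_le
  have hKt : C * WPFP.wtConst ≠ ⊤ := ENNReal.mul_ne_top hCt WPFP.wtConst_ne_top
  -- `C` comes from the squared estimate in terms of `‖𝓕 n‖₂²`, and `wtConst` from bounding `‖n‖₂²`
  -- by `‖z‖²`; neither depends on `u` or `g`.
  refine ⟨√(C * WPFP.wtConst).toReal, fun u g h => ?_⟩
  have hmaj : ∀ z, WPFP.majorantSq u z ≤ C * (ENNReal.ofReal ‖u‖ ^ 2 + ENNReal.ofReal ‖g‖ ^ 2) *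
      (WPFP.wtConst * ENNReal.ofReal ‖z‖ ^ 2) := fun z => WPFP.majorantSq_le z (hC u g h)
  have hfin : ∀ z, WPFP.majorantSq u z < ⊤ := fun z => (hmaj z).trans_lt
    (ENNReal.mul_lt_top (ENNReal.mul_lt_top hCt.lt_top (ENNReal.add_lt_top.2
      ⟨ENNReal.pow_lt_top ENNReal.ofReal_lt_top, ENNReal.pow_lt_top ENNReal.ofReal_lt_top⟩))
      (ENNReal.mul_lt_top WPFP.wtConst_ne_top.lt_top (ENNReal.pow_lt_top ENNReal.ofReal_lt_top)))
  have hbound : ∀ z, ‖WPFP.wignerLinearMap u hfin z‖ ≤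
      √(C * WPFP.wtConst).toReal * (‖u‖ + ‖g‖) * ‖z‖ := by
    intro z
    refine WPFP.le_of_ofReal_sq_le hKt (norm_nonneg _) (norm_nonneg _) (norm_nonneg _) ?_
    refine (WPFP.norm_wignerLinearMap_sq_le u hfin z).trans ((hmaj z).trans (le_of_eq ?_))
    ring
  exact ⟨(WPFP.wignerLinearMap u hfin).mkContinuous _ hbound, fun z =>
    ⟨WPFP.isWignerOp_wignerLinearMap u hfin z, hbound z⟩⟩
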